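/- **Setting.** Let $D\ge 0$, let $k_D$ be a continuous covariance function (symmetric, positive semidefinite) on $[0,1]^D\times[0,1]^D$, let $\mathcal C_D\subseteq \mathcal C([0,1]^D,\mathbb R)$, and let $\mathcal J\subseteq\{1,\dots,D\}$ with $d=|\mathcal J|$; vectors in $[0,1]^d$ are indexed by $\mathcal J$. Put $k(u,v)=k_D(\tilde u,\tilde v)$ on $[0,1]^d\times[0,1]^d$, where $\tilde u$ has coordinates $u$ on $\mathcal J$ and $0$ elsewhere, and $\mathcal C=\{g:[0,1]^d\to\mathbb R\ ;\ (x\mapsto g(x_{\mathcal J}))\in\mathcal C_D\}$. Let $\mathcal H$ be the RKHS of $k$. Let $x_D^{(1)},\dots,x_D^{(n)}\in[0,1]^D$, $x^{(i)}=(x_D^{(i)})_{\mathcal J}$, $X=(x^{(1)},\dots,x^{(n)})$ and $y^{(n)}=(y_1,\dots,y_n)\in\mathbb R^n$. For points $U=(u_1,\dots,u_r)$ of $[0,1]^d$ and $v\in\mathbb R^r$ let $\mathcal I_{U,v}$ be the set of $f:[0,1]^d\to\mathbb R$ with $f(u_i)=v_i$ for all $i$. A one-dimensional subdivision is a finite set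 of knots $-1=t_{(0)}<0=t_{(1)}<\dots<t_{(m)}=1<t_{(m+1)}=2$. A subdivision $S=(S_i)_{i\in\mathcal J}$ is a vector of one-dimensional subdivisions, with multi-indices $\underline\ell\in\mathcal L_S=\prod_i\{1,\dots,m_{S_i}\}$, multi-dimensional knots $t^{(S)}_{\underline\ell}=(t^{(S_i)}_{(\ell_i)})_i$ and basis functions $\phi^{(S)}_{\underline\ell}(t)=\prod_i\phi_{t^{(S_i)}_{(\ell_i-1)},t^{(S_i)}_{(\ell_i)},t^{(S_i)}_{(\ell_i+1)}}(t_i)$. Here $\phi_{u,v,w}$ is the hat function which vanishes outside $[u,w]$, equals $1$ at $v$, and is affine on $[u,v]$ and on $[v,w]$. For $\alpha\in\mathbb R^{\mathcal L_S}$ put $Y_{S,\alpha}=\sum_{\underline\ell}\alpha_{\underline\ell}\phi^{(S)}_{\underline\ell}$, and put $\pi_S(f)=\sum_{\underline\ell}f(t^{(S)}_{\underline\ell})\phi^{(S)}_{\underline\ell}$. Assume that the matrix $k(S,S)=(k(t^{(S)}_{\underline\ell},t^{(S)}_{\underline\ell'}))_{\underline\ell,\underline\ell'}$ is invertible for every subdivision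 $S$. Define $$\widehat\alpha_S=\operatorname*{argmin}_{\alpha:\ Y_{S,\alpha}\in\mathcal I_{X,y^{(n)}}\cap\mathcal C}\alpha^\top k(S,S)^{-1}\alpha,\qquad \widehat Y_S=Y_{S,\widehat\alpha_S}.$$ Let $(S^{(m)})_{m\ge m_0}$ be subdivisions that are nested, $S^{(m)}_i\subseteq S^{(m+1)}_i$ for all $i$ and all $m\ge m_0$ (their knots need not be dense). Let $F_i=[0,1]\cap\overline{\bigcup_{m\ge m_0}S_i^{(m)}}$ and $F=\prod_iF_i$. For $f:F\to\mathbb R$ the multiaffine extension is $$P_{F\to[0,1]^d}f(t)=\sum_{\epsilon\in\{-,+\}^{\mathcal J}}\Big(\prod_j\omega_{\epsilon_j}(t_j)\Big)f\big((t_j^{\epsilon_j})_j\big),$$ where $t_j^-=\max\{u\in F_j;u\le t_j\}$, $t_j^+=\min\{u\in F_j;u\ge t_j\}$, $\omega_+(t_j)=(t_j-t_j^-)/(t_j^+-t_j^-)$ if $t_j\notin F_j$ and $\omega_+(t_j)=0$ if $t_j\in F_j$, and $\omega_-=1-\omega_+$. Let $\mathcal C_F=\{f:F\to\mathbb R\ ;\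 P_{F\to[0,1]^d}f\in\mathcal C\}$ and $\mathcal I_{F,X,y^{(n)}}=\{f:F\to\mathbb R\ ;\ P_{F\to[0,1]^d}f\in\mathcal I_{X,y^{(n)}}\}$, and let $\mathcal H_F$ be the RKHS of the restriction $k_F$ of $k$ to $F\times F$. **Theorem.** Let $\overset{\bullet}{\mathcal C}\subseteq\mathcal C$ and assume the following six conditions. 1. $\mathcal C_D$ is convex, and closed for uniform convergence. 2. There is $\alpha$ with $Y_{S^{(m_0)},\alpha}\in\mathcal I_{X,y^{(n)}}\cap\overset{\bullet}{\mathcal C}$. 3. $\{(Y_{S^{(m_0)},\alpha}(x^{(i)}))_{i=1,\dots,n}\ ;\ \alpha\in\mathbb R^{\mathcal L_{S^{(m_0)}}}\}=\mathbb R^n$. 4. For all $h\in\overset{\bullet}{\mathcal C}$, all $r\in\mathbb N$ and all two-by-two distinct $u_1,\dots,u_r\in[0,1]^d$, with $U=(u_1,\dots,u_r)$ and $v=(h(u_1),\dots,h(u_r))$, the set $\mathrm{int}_{\|\cdot\|_{\mathcal H}}(\mathcal H\cap\mathcal C)\cap\mathcal I_{U,v}$ is non-empty. 5. $\pi_S(\mathcal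 C)\subseteq\mathcal C$ for every subdivision $S$. 6. $P_{F\to[0,1]^d}(f_{|F})\in\mathcal C$ for every $f\in\mathcal C$. Then $\widehat\alpha_{S^{(m)}}$ exists and is unique for every $m\ge m_0$, the minimizer $$Y_{F,\mathrm{opt}}=\operatorname*{argmin}_{f\in\mathcal H_F\cap\mathcal C_F\cap\mathcal I_{F,X,y^{(n)}}}\|f\|_{\mathcal H_F}$$ exists and is unique, and, as $m\to\infty$, $\widehat Y_{S^{(m)}}$ converges uniformly on $[0,1]^d$ to $P_{F\to[0,1]^d}(Y_{F,\mathrm{opt}})$. -/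

import Mathlib

noncomputable section

namespace ConstrainedMode

/-- The unit cube `[0,1]^ι`, with the product topology. -/
abbrev Cube (ι : Type*) : Type _ := ι → Set.Icc (0 : ℝ) 1

/-- `a` is an argmin of `Q` over the set `A`. -/
def IsArgmin {X : Type*} (A : Set X) (Q : X → ℝ) (a : X) : Prop :=
  a ∈ A ∧ IsMinOn Q A a

/-- The set of plain functions underlying a set of continuous functions. -/
def asFunctions {X : Type*} [TopologicalSpace X] (C : Set C(X, ℝ)) : Set (X → ℝ) :=
  (fun g : C(X, ℝ) => (g : X → ℝ)) '' C

/-! ### Subdivisions, hat functions, and the spline spaces -/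

/-- The asymmetric hat function `φ_{u,v,w}`, centred at `v`, with support `[u,w]`. -/
def hat (u v w t : ℝ) : ℝ :=
  if u ≤ t ∧ t ≤ v then (t - u) / (v - u)
  else if v ≤ t ∧ t ≤ w then (w - t) / (w - v)
  else 0

/-- A one-dimensional subdivision, given by its ordered knots
`-1 = t_(0) < 0 = t_(1) < ⋯ < t_(size) = 1 < t_(size+1) = 2`. -/
structure Subdivision where
  size : ℕ
  knot : Fin (size + 2) → ℝ
  strictMono : StrictMono knot
  knot_zero : knot 0 = -1
  knot_one : knot 1 = 0
  knot_size : knot (Fin.last size).castSucc = 1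
  knot_last : knot (Fin.last (size + 1)) = 2

namespace Subdivision

/-- The set of knots of a subdivision. -/
def knotSet (S : Subdivision) : Set ℝ := Set.range S.knot

/-- The `ℓ`-th knot in `[0,1]`; the index `ℓ = 0, …, size - 1` stands for `t_(ℓ+1)`. -/
def center (S : Subdivision) (l : Fin S.size) : ℝ := S.knot l.succ.castSucc

/-- The knot that precedes `center l`. -/
def left (S : Subdivision) (l : Fin S.size) : ℝ := S.knot l.castSucc.castSucc

/-- The knot that follows `center l`. -/
def right (S : Subdivision) (l : Fin S.size) : ℝ := S.knot l.succ.succ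

theorem center_mem (S : Subdivision) (l : Fin S.size) :
    S.center l ∈ Set.Icc (0 : ℝ) 1 := by
  constructor
  · rw [← S.knot_one]
    apply S.strictMono.monotone
    rw [Fin.le_def]
    simp
  · rw [← S.knot_size]
    apply S.strictMono.monotone
    rw [Fin.le_def]
    have := l.isLt
    simp only [Fin.val_castSucc, Fin.val_succ, Fin.val_last]
    omega

/-- `center l` as a point of `[0,1]`. -/
def point (S : Subdivision) (l : Fin S.size) : Set.Icc (0 : ℝ) 1 :=
  ⟨S.center l, S.center_mem l⟩

end Subdivision

section Splines

variable {ι : Type*} [Fintype ι] [DecidableEq ι]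

/-- The multi-indices of a multi-dimensional subdivision `S = (S_i)_i`. -/
abbrev MultiIndex (S : ι → Subdivision) : Type _ := (i : ι) → Fin (S i).size

/-- The multi-dimensional knot with multi-index `l`. -/
def gridPoint (S : ι → Subdivision) (l : MultiIndex S) : Cube ι :=
  fun i => (S i).point (l i)

/-- The tensorized hat function with multi-index `l`. -/
def basisFun (S : ι → Subdivision) (l : MultiIndex S) (t : Cube ι) : ℝ :=
  ∏ i, hat ((S i).left (l i)) ((S i).center (l i)) ((S i).right (l i)) (t i)

/-- The spline `Y_{S,α} = ∑_l α_l φ_l^{(S)}`. -/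
def spline (S : ι → Subdivision) (α : MultiIndex S → ℝ) (t : Cube ι) : ℝ :=
  ∑ l, α l * basisFun S l t

/-- The projection `π_S f = ∑_l f(t_l) φ_l^{(S)}`. -/
def proj (S : ι → Subdivision) (f : Cube ι → ℝ) : Cube ι → ℝ :=
  spline S fun l => f (gridPoint S l)

end Splines

/-- The functions that take the value `v i` at the point `U i`, for all `i`. -/
def interpolating {X : Type*} {n : ℕ} (U : Fin n → X) (v : Fin n → ℝ) : Set (X → ℝ) :=
  {f | ∀ i, f (U i) = v i}

/-! ### Covariance kernels and their reproducing kernel Hilbert spaces -/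

/-- A covariance function on `X`: symmetric, and positive semidefinite on finite families. -/
structure CovKernel (X : Type*) where
  toFun : X → X → ℝ
  posSemidef : (Matrix.of toFun).PosSemidef

namespace CovKernel

/-- The kernel `(x, y) ↦ k (g x, g y)`. -/
def comap {X Y : Type*} (k : CovKernel X) (g : Y → X) : CovKernel Y where
  toFun x y := k.toFun (g x) (g y)
  posSemidef := k.posSemidef.submatrix g

/-- The kernel as an operator-valued matrix: `k(x,y)` acts on `ℝ` by multiplication. -/
def op {X : Type*} (k : CovKernel X) : Matrix X X (ℝ →L[ℝ] ℝ) :=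
  Matrix.of fun x y => k.toFun x y • ContinuousLinearMap.id ℝ ℝ

instance fact_posSemidef_op {X : Type*} (k : CovKernel X) : Fact k.op.PosSemidef := by
  have hsymm : ∀ x y, k.toFun y x = k.toFun x y := fun x y => by
    simpa using k.posSemidef.1.apply x y
  constructor
  refine ((RKHS.posSemidef_tfae (K := k.op)).out 0 2 rfl rfl).mpr ⟨?_, fun c => ?_⟩
  · refine Matrix.IsHermitian.ext fun x y => ?_
    have hid : star (ContinuousLinearMap.id ℝ ℝ) = ContinuousLinearMap.id ℝ ℝ :=
      star_one (ℝ →L[ℝ] ℝ)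
    simp only [op, Matrix.of_apply, star_smul, star_trivial, hid, hsymm x y]
  · have h := k.posSemidef.2 c
    simp only [star_trivial, Matrix.of_apply] at h
    refine h.trans_eq ?_
    rw [RCLike.re_to_real]
    refine Finsupp.sum_congr fun x _ => Finsupp.sum_congr fun y _ => ?_
    have hop : (k.op y x) (c x) = k.toFun x y * c x := by
      change (k.toFun y x • ContinuousLinearMap.id ℝ ℝ) (c x) = _
      rw [hsymm x y]
      simp
    rw [hop]
    simp
    ring

/-- The reproducing kernel Hilbert space of functions `X → ℝ` with kernel `k`. -/
abbrev Space {X : Type*} (k : CovKernel X) : Type _ := RKHS.OfKernel k.op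

/-- The covariance matrix `k(S,S)` at the knots of `S`. -/
def gridMatrix {ι : Type*} (k : CovKernel (Cube ι)) (S : ι → Subdivision) :
    Matrix (MultiIndex S) (MultiIndex S) ℝ :=
  Matrix.of fun l l' => k.toFun (gridPoint S l) (gridPoint S l')

end CovKernel

section Mode

variable {ι : Type*} [Fintype ι] [DecidableEq ι]

/-- `α` is the coefficient vector `α̂_{S,U,v}` of the constrained mode: it minimizes
`αᵀ k(S,S)⁻¹ α` among the `α` such that `Y_{S,α}` interpolates `v` at `U` and is in `C`. -/
def IsModeCoeff (k : CovKernel (Cube ι)) (C : Set C(Cube ι, ℝ)) {n : ℕ}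
    (U : Fin n → Cube ι) (v : Fin n → ℝ) (S : ι → Subdivision) (α : MultiIndex S → ℝ) : Prop :=
  IsArgmin {β : MultiIndex S → ℝ | spline S β ∈ interpolating U v ∩ asFunctions C}
    (fun β => β ⬝ᵥ ((k.gridMatrix S)⁻¹).mulVec β) α

end Mode

/-! ### Active variables -/

section Active

variable {D : ℕ} (J : Finset (Fin D))

/-- `x ↦ x_J`, keeping the active coordinates. -/
def restrictTo : C(Cube (Fin D), Cube J) :=
  ⟨fun x i => x i, by fun_prop⟩

/-- `u ↦ ũ`, setting the inactive coordinates to `0`. -/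
def extendZero (u : Cube J) : Cube (Fin D) :=
  fun i => if h : i ∈ J then u ⟨i, h⟩ else 0

/-- The functions of the active variables which are in `CD` as functions of all variables. -/
def activeConstraints (CD : Set C(Cube (Fin D), ℝ)) : Set C(Cube J, ℝ) :=
  {g | g.comp (restrictTo J) ∈ CD}

/-- The covariance function `k_J (u, v) = k_D (ũ, ṽ)`. -/
def activeKernel (kD : CovKernel (Cube (Fin D))) : CovKernel (Cube J) :=
  kD.comap (extendZero J)

end Active

/-! ### The multiaffine extension -/

/-- A closed subset of `[0,1]` that contains `0` and `1`. -/
structure AxisSet where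
  carrier : Set (Set.Icc (0 : ℝ) 1)
  isClosed : IsClosed carrier
  zero_mem : 0 ∈ carrier
  one_mem : 1 ∈ carrier

namespace AxisSet

variable (B : AxisSet)

/-- The closest left neighbour `t⁻ = max {u ∈ B | u ≤ t}`. -/
def lower (t : Set.Icc (0 : ℝ) 1) : Set.Icc (0 : ℝ) 1 := sSup {u | u ∈ B.carrier ∧ u ≤ t}

/-- The closest right neighbour `t⁺ = min {u ∈ B | t ≤ u}`. -/
def upper (t : Set.Icc (0 : ℝ) 1) : Set.Icc (0 : ℝ) 1 := sInf {u | u ∈ B.carrier ∧ t ≤ u}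

/-- The neighbour `t⁺` (for `true`) or `t⁻` (for `false`). -/
def nbr (e : Bool) (t : Set.Icc (0 : ℝ) 1) : Set.Icc (0 : ℝ) 1 :=
  if e then B.upper t else B.lower t

/-- `ω₊(t) = (t - t⁻) / (t⁺ - t⁻)` (for `true`) or `ω₋(t) = 1 - ω₊(t)` (for `false`).
For `t ∈ B` one has `t⁻ = t = t⁺`; then `ω₊(t) = 0` and `ω₋(t) = 1`. -/
def weight (e : Bool) (t : Set.Icc (0 : ℝ) 1) : ℝ :=
  if e then ((t : ℝ) - B.lower t) / ((B.upper t : ℝ) - B.lower t)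
  else 1 - ((t : ℝ) - B.lower t) / ((B.upper t : ℝ) - B.lower t)

theorem nbr_mem (e : Bool) (t : Set.Icc (0 : ℝ) 1) : B.nbr e t ∈ B.carrier := by
  cases e
  · have hc : IsCompact {u | u ∈ B.carrier ∧ u ≤ t} :=
      (B.isClosed.inter isClosed_Iic).isCompact
    exact (hc.sSup_mem ⟨0, B.zero_mem, t.2.1⟩).1
  · have hc : IsCompact {u | u ∈ B.carrier ∧ t ≤ u} :=
      (B.isClosed.inter isClosed_Ici).isCompact
    exact (hc.sInf_mem ⟨1, B.one_mem, t.2.2⟩).1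

end AxisSet

section Extension

variable {ι : Type*}

/-- The product set `F = ∏ F_i`. -/
def prodSet (F : ι → AxisSet) : Set (Cube ι) := {t | ∀ i, t i ∈ (F i).carrier}

/-- The multiaffine extension `P_{F → [0,1]^ι} f`,
`t ↦ ∑_ε (∏_j ω_{ε_j}(t_j)) f(t_1^{ε_1}, …, t_d^{ε_d})`. -/
def multiaffineExt [Fintype ι] [DecidableEq ι] (F : ι → AxisSet) (f : prodSet F → ℝ)
    (t : Cube ι) : ℝ :=
  ∑ e : ι → Bool, (∏ j, (F j).weight (e j) (t j)) *
    f ⟨fun j => (F j).nbr (e j) (t j), fun j => (F j).nbr_mem (e j) (t j)⟩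

/-- `F_i = [0,1] ∩ closure (⋃_{m ≥ m₀} S_i^{(m)})`. -/
def knotClosure (m₀ : ℕ) (S : ℕ → ι → Subdivision) (i : ι) : AxisSet where
  carrier := {t | (t : ℝ) ∈ closure (⋃ m ≥ m₀, (S m i).knotSet)}
  isClosed := isClosed_closure.preimage continuous_subtype_val
  zero_mem := subset_closure
    (Set.mem_biUnion (le_refl m₀) ⟨1, (S m₀ i).knot_one⟩)
  one_mem := subset_closure
    (Set.mem_biUnion (le_refl m₀) ⟨_, (S m₀ i).knot_size⟩)

variable [Fintype ι] [DecidableEq ι]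

/-- `C_F`, the functions on `F` whose multiaffine extension is in `C`. -/
def pullbackConstraints (F : ι → AxisSet) (C : Set C(Cube ι, ℝ)) : Set (prodSet F → ℝ) :=
  {f | multiaffineExt F f ∈ asFunctions C}

/-- `I_{F,X,y}`, the functions on `F` whose multiaffine extension interpolates `y` at `X`. -/
def pullbackInterpolating (F : ι → AxisSet) {n : ℕ} (U : Fin n → Cube ι) (v : Fin n → ℝ) :
    Set (prodSet F → ℝ) :=
  {f | multiaffineExt F f ∈ interpolating U v}

/-- The kernel `k_F`, the restriction of `k` to `F × F`. -/
def restrictKernel (F : ι → AxisSet) (k : CovKernel (Cube ι)) : CovKernel (prodSet F) :=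
  k.comap Subtype.val

/-- `Y` is `Y_{F,opt}`: it has the least norm among the elements of the reproducing kernel
Hilbert space of `k_F` which, as functions on `F`, are in `C_F ∩ I_{F,X,y}`. -/
def IsOptimal (F : ι → AxisSet) (k : CovKernel (Cube ι)) (C : Set C(Cube ι, ℝ)) {n : ℕ}
    (U : Fin n → Cube ι) (v : Fin n → ℝ) (Y : (restrictKernel F k).Space) : Prop :=
  IsArgmin {f : (restrictKernel F k).Space |
      (f : prodSet F → ℝ) ∈ pullbackConstraints F C ∩ pullbackInterpolating F U v}
    (fun f => ‖f‖) Y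

end Extension

/-! ### The technical conditions -/

section Conditions

variable {ι : Type*} [Fintype ι] [DecidableEq ι]

/-- Initial knots flexibility, 1: some spline on `S₀` interpolates and is in `C•`. -/
def StrictlyFeasible (Cdot : Set C(Cube ι, ℝ)) {n : ℕ} (U : Fin n → Cube ι) (v : Fin n → ℝ)
    (S₀ : ι → Subdivision) : Prop :=
  {α : MultiIndex S₀ → ℝ | spline S₀ α ∈ interpolating U v ∩ asFunctions Cdot}.Nonempty

/-- Initial knots flexibility, 2: the splines on `S₀` attain all of `ℝⁿ` at the points `U`. -/
def SpansValues {n : ℕ} (U : Fin n → Cube ι) (S₀ : ι → Subdivision) : Prop :=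
  {w : Fin n → ℝ | ∃ α : MultiIndex S₀ → ℝ, w = fun i => spline S₀ α (U i)} = Set.univ

/-- RKHS interior: for every `h ∈ C•` and all distinct `u_1, …, u_r`, some element of the interior
of `H ∩ C` in the Hilbert norm agrees with `h` at `u_1, …, u_r`. -/
def RKHSInterior (k : CovKernel (Cube ι)) (C Cdot : Set C(Cube ι, ℝ)) : Prop :=
  ∀ h ∈ Cdot, ∀ (r : ℕ) (U : Fin r → Cube ι), Function.Injective U →
    (interior {f : k.Space | (f : Cube ι → ℝ) ∈ asFunctions C} ∩
      {f : k.Space | (f : Cube ι → ℝ) ∈ interpolating U fun i => h (U i)}).Nonempty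

/-- Stability by projection: `π_S C ⊆ C` for every subdivision `S`. -/
def ProjectionStable (C : Set C(Cube ι, ℝ)) : Prop :=
  ∀ S : ι → Subdivision, ∀ f ∈ C, proj S f ∈ asFunctions C

/-- Stability by multiaffine extension: `P_{F → [0,1]^ι} (f|_F) ∈ C` for `f ∈ C`. -/
def ExtensionStable (F : ι → AxisSet) (C : Set C(Cube ι, ℝ)) : Prop :=
  ∀ f ∈ C, multiaffineExt F (fun t => f t.1) ∈ asFunctions C

end Conditions

end ConstrainedMode

end

open ConstrainedMode

/-! All the minimization problems are moved to the single Hilbert space `H_F`. It embeds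
isometrically into `H` by an operator `E` with `(E f)|_F = f`
(`CovKernel.exists_isometric_extension`). Put `T_m = π_{S^(m)} ∘ E`, with values in the continuous
functions. As the knots lie in `F`, the form `αᵀ k(S,S)⁻¹ α` is the least squared norm of an element
of `H_F` with knot values `α` (`exists_coeffLift`). So the coefficient problem amounts to minimizing
`‖f‖` subject to `T_m f ∈ C` and `T_m f (X) = y`. The limit problem has the same form, with `T' f =
P_F f` in place of `T_m f`. Existence and uniqueness are those of the point of least norm in a
nonempty closed convex set.

The operators `T_m` converge to `T'` in norm (`exists_abs_proj_sub_multiaffineExt_le`). A spline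
with knots in `F` is its own multiaffine extension, so it suffices to bound the projection error on
`F`. There every point is uniformly close to knots, and the balls of `H` are equicontinuous because
`k(·, x)` depends continuously on `x`.

It remains to pass to the limit in the minimizers (`tendsto_isArgmin_feasibleSet`). The inequality
constraints are nested: `T_p f ∈ C` or `T' f ∈ C` implies `T_m f ∈ C` for `m ≤ p`. The interpolation
equations are not, but by norm convergence they fail by little on bounded sets.
`exists_feasible_near` repairs them by mixing in a small multiple of `g₀ + w`, where `g₀` is an
interior point of the limit problem and `w` corrects the values; surjectivity of `f ↦ T' f (X)`
keeps `w` small. Hence the minimizers `f_m` have norms asymptotically at most that of the limit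
solution, and a later `f_p` is close to a feasible point of problem `m`. The norms are then almost
nondecreasing, so they converge, and the projection inequality makes `(f_m)` Cauchy. Its limit is
feasible and has least norm. -/

namespace ConstrainedMode

/-! ### Hat functions -/

/-- `u` coincides on `[a, b]` with an affine function. -/
def AffineOnSegment (u : ℝ → ℝ) (a b : ℝ) : Prop :=
  ∀ t, a ≤ t → t ≤ b → (b - a) * u t = (b - t) * u a + (t - a) * u b

theorem hat_eq_left {u v w t : ℝ} (hut : u ≤ t) (htv : t ≤ v) :
    hat u v w t = (t - u) / (v - u) := by
  simp [hat, hut, htv]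

theorem hat_eq_right {u v w t : ℝ} (huv : u < v) (hvw : v < w) (hvt : v ≤ t) (htw : t ≤ w) :
    hat u v w t = (w - t) / (w - v) := by
  -- At the centre the definition takes its left branch; both branches equal 1 there.
  rcases hvt.eq_or_lt with rfl | h
  · rw [hat_eq_left huv.le le_rfl, div_self (sub_pos.2 huv).ne', div_self (sub_pos.2 hvw).ne']
  · simp [hat, not_le.2 h, hvt, htw]

theorem hat_eq_zero_of_le {u v w t : ℝ} (huv : u < v) (h : t ≤ u) : hat u v w t = 0 := by
  rcases h.eq_or_lt with rfl | h
  · rw [hat_eq_left le_rfl huv.le]; simp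
  · simp [hat, not_le.2 h, not_le.2 (h.trans huv)]

theorem hat_eq_zero_of_ge {u v w t : ℝ} (huv : u < v) (hvw : v < w) (h : w ≤ t) :
    hat u v w t = 0 := by
  rcases h.eq_or_lt with rfl | h
  · rw [hat_eq_right huv hvw hvw.le le_rfl]; simp
  · simp [hat, not_le.2 h, not_le.2 (hvw.trans h)]

theorem hat_self {u v w : ℝ} (huv : u < v) : hat u v w v = 1 := by
  rw [hat_eq_left huv.le le_rfl, div_self (sub_pos.2 huv).ne']

theorem hat_nonneg (u v w t : ℝ) : 0 ≤ hat u v w t := by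
  unfold hat
  split_ifs with h h'
  · exact div_nonneg (by linarith) (by linarith)
  · exact div_nonneg (by linarith) (by linarith)
  · rfl

/-- A hat is the positive part of the minimum of its two affine branches, which avoids any gluing.
-/
theorem continuous_hat {u v w : ℝ} (huv : u < v) (hvw : v < w) : Continuous (hat u v w) := by
  have h : hat u v w = fun t => max 0 (min ((t - u) / (v - u)) ((w - t) / (w - v))) := by
    funext t
    have h1 : 0 < v - u := sub_pos.2 huv
    have h2 : 0 < w - v := sub_pos.2 hvw
    rcases le_total t u with h | h
    · rw [hat_eq_zero_of_le huv h, max_eq_left]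
      exact (min_le_left _ _).trans (div_nonpos_of_nonpos_of_nonneg (by linarith) h1.le)
    rcases le_total w t with h' | h'
    · rw [hat_eq_zero_of_ge huv hvw h', max_eq_left]
      exact (min_le_right _ _).trans (div_nonpos_of_nonpos_of_nonneg (by linarith) h2.le)
    have h3 : 0 ≤ (t - u) / (v - u) := div_nonneg (by linarith) h1.le
    have h4 : 0 ≤ (w - t) / (w - v) := div_nonneg (by linarith) h2.le
    rw [max_eq_right (le_min h3 h4)]
    rcases le_total t v with h'' | h''
    · rw [hat_eq_left h h'', min_eq_left]
      exact ((div_le_one h1).2 (by linarith)).trans ((one_le_div h2).2 (by linarith))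
    · rw [hat_eq_right huv hvw h'' h', min_eq_right]
      exact ((div_le_one h2).2 (by linarith)).trans ((one_le_div h1).2 (by linarith))
  rw [h]
  fun_prop

/-- A hat function is affine on every segment without knots in its interior. -/
theorem affineOnSegment_hat {u v w a b : ℝ} (huv : u < v) (hvw : v < w)
    (hu : u ≤ a ∨ b ≤ u) (hv : v ≤ a ∨ b ≤ v) (hw : w ≤ a ∨ b ≤ w) :
    AffineOnSegment (hat u v w) a b := by
  intro t hat' htb
  have h1 : v - u ≠ 0 := (sub_pos.2 huv).ne'
  have h2 : w - v ≠ 0 := (sub_pos.2 hvw).ne'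
  rcases hu with hu | hu
  · rcases hv with hv | hv
    · rcases hw with hw | hw
      · rw [hat_eq_zero_of_ge huv hvw (hw.trans hat'), hat_eq_zero_of_ge huv hvw hw,
          hat_eq_zero_of_ge huv hvw (hw.trans (hat'.trans htb))]
        ring
      · rw [hat_eq_right huv hvw (hv.trans hat') (htb.trans hw),
          hat_eq_right huv hvw hv (hat'.trans (htb.trans hw)),
          hat_eq_right huv hvw (hv.trans (hat'.trans htb)) hw]
        field_simp
        ring
    · rw [hat_eq_left (hu.trans hat') (htb.trans hv), hat_eq_left hu (hat'.trans (htb.trans hv)),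
        hat_eq_left (hu.trans (hat'.trans htb)) hv]
      field_simp
      ring
  · rw [hat_eq_zero_of_le huv (htb.trans hu), hat_eq_zero_of_le huv hu,
      hat_eq_zero_of_le huv (hat'.trans (htb.trans hu))]
    ring

theorem affineOnSegment_abs_sub {c a b : ℝ} (h : c ≤ a ∨ b ≤ c) :
    AffineOnSegment (fun t => |t - c|) a b := by
  intro t h1 h2
  rcases h with h | h
  · simp only
    rw [abs_of_nonneg (by linarith), abs_of_nonneg (by linarith), abs_of_nonneg (by linarith)]
    ring
  · simp only
    rw [abs_of_nonpos (by linarith), abs_of_nonpos (by linarith), abs_of_nonpos (by linarith)]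
    ring

/-! ### One-dimensional interpolation -/

namespace Subdivision

variable (S : Subdivision)

/-- The hat function centred at `center l`. -/
noncomputable def hatAt (l : Fin S.size) (t : ℝ) : ℝ := hat (S.left l) (S.center l) (S.right l) t

theorem left_lt_center (l : Fin S.size) : S.left l < S.center l :=
  S.strictMono (by rw [Fin.lt_def]; simp)

theorem center_lt_right (l : Fin S.size) : S.center l < S.right l :=
  S.strictMono (by rw [Fin.lt_def]; simp)

/-- For size 0 or 1, the knot of index 1, with value 0, would also be the knot with value 2 or the
one with value 1. -/
theorem two_le_size : 2 ≤ S.size := by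
  rcases S with ⟨n, f, hm, h0, h1, hs, hl⟩
  match n, f, hm, h0, h1, hs, hl with
  | 0, f, hm, h0, h1, hs, hl =>
    have : (1 : Fin 2) = Fin.last 1 := rfl
    rw [this] at h1
    change f (Fin.last 1) = 2 at hl
    rw [h1] at hl
    norm_num at hl
  | 1, f, hm, h0, h1, hs, hl =>
    have : (1 : Fin 3) = (Fin.last 1).castSucc := rfl
    rw [this, hs] at h1
    norm_num at h1
  | n + 2, _, _, _, _, _, _ => simp

theorem center_strictMono : StrictMono S.center := fun a b h =>
  S.strictMono (by rw [Fin.lt_def] at h ⊢; simpa using h)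

theorem center_zero {l : Fin S.size} (h : l.val = 0) : S.center l = 0 := by
  rw [← S.knot_one, center]
  congr 1
  ext
  have := S.two_le_size
  simp [h]

theorem center_last {l : Fin S.size} (h : l.val + 1 = S.size) : S.center l = 1 := by
  rw [← S.knot_size, center]
  congr 1
  ext
  simp [h]

theorem center_mem_knotSet (l : Fin S.size) : S.center l ∈ S.knotSet := ⟨_, rfl⟩
theorem left_mem_knotSet (l : Fin S.size) : S.left l ∈ S.knotSet := ⟨_, rfl⟩
theorem right_mem_knotSet (l : Fin S.size) : S.right l ∈ S.knotSet := ⟨_, rfl⟩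

theorem exists_center_eq {t : ℝ} (ht : t ∈ S.knotSet) (h0 : -1 < t) (h1 : t < 2) :
    ∃ l, S.center l = t := by
  obtain ⟨j, rfl⟩ := ht
  have hj0 : j.val ≠ 0 := by
    intro h
    have : j = 0 := Fin.ext h
    rw [this, S.knot_zero] at h0
    exact lt_irrefl _ h0
  have hj1 : j.val ≠ S.size + 1 := by
    intro h
    have : j = Fin.last _ := Fin.ext h
    rw [this, S.knot_last] at h1
    exact lt_irrefl _ h1
  have := j.isLt
  refine ⟨⟨j.val - 1, by omega⟩, ?_⟩
  rw [center]
  congr 1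
  ext
  simp
  omega

theorem hatAt_center (l l' : Fin S.size) : S.hatAt l (S.center l') = if l = l' then 1 else 0 := by
  rcases lt_trichotomy l l' with h | rfl | h
  · rw [if_neg h.ne, hatAt, hat_eq_zero_of_ge (S.left_lt_center l) (S.center_lt_right l)]
    refine S.strictMono.monotone ?_
    rw [Fin.lt_def] at h
    rw [Fin.le_def]
    simpa using h
  · rw [if_pos rfl, hatAt, hat_self (S.left_lt_center l)]
  · rw [if_neg h.ne', hatAt, hat_eq_zero_of_le (S.left_lt_center l)]
    refine S.strictMono.monotone ?_
    rw [Fin.lt_def] at h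
    rw [Fin.le_def]
    simpa using h

/-- Otherwise, by induction, every centre would be at most `t`, and the last one, which is 1, would
be strictly below `t`. -/
theorem exists_consecutive {t : ℝ} (ht : t ∈ Set.Icc (0 : ℝ) 1) :
    ∃ a b : Fin S.size, a.val + 1 = b.val ∧ S.center a ≤ t ∧ t ≤ S.center b := by
  have hs := S.two_le_size
  by_contra! hcon
  have key : ∀ j (hj : j < S.size), S.center ⟨j, hj⟩ ≤ t := by
    intro j
    induction j with
    | zero => intro hj; rw [S.center_zero rfl]; exact ht.1
    | succ j ih =>
      intro hj
      exact (hcon ⟨j, by omega⟩ ⟨j + 1, hj⟩ rfl (ih _)).le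
  have h1 := hcon ⟨S.size - 2, by omega⟩ ⟨S.size - 1, by omega⟩ (by simp; omega) (key _ _)
  rw [S.center_last (by simp; omega)] at h1
  exact absurd ht.2 (not_le.2 h1)

theorem knot_le_or_ge {a b : Fin S.size} (hab : a.val + 1 = b.val) {c : ℝ} (hc : c ∈ S.knotSet) :
    c ≤ S.center a ∨ S.center b ≤ c := by
  obtain ⟨j, rfl⟩ := hc
  rcases le_or_gt j a.succ.castSucc with h | h
  · exact .inl (S.strictMono.monotone h)
  · refine .inr (S.strictMono.monotone ?_)
    rw [Fin.lt_def] at h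
    rw [Fin.le_def]
    simp at h ⊢
    omega

theorem affineOnSegment_hatAt {l : Fin S.size} {a b : ℝ}
    (h : ∀ c ∈ S.knotSet, c ≤ a ∨ b ≤ c) : AffineOnSegment (S.hatAt l) a b :=
  affineOnSegment_hat (S.left_lt_center l) (S.center_lt_right l) (h _ (S.left_mem_knotSet l))
    (h _ (S.center_mem_knotSet l)) (h _ (S.right_mem_knotSet l))

/-- A function which is affine between consecutive knots is the combination of the hat functions
with its values at the knots. -/
theorem sum_hatAt_mul {u : ℝ → ℝ}
    (hu : ∀ a b : Fin S.size, a.val + 1 = b.val → AffineOnSegment u (S.center a) (S.center b))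
    {t : ℝ} (ht : t ∈ Set.Icc (0 : ℝ) 1) : ∑ l, S.hatAt l t * u (S.center l) = u t := by
  obtain ⟨a, b, hab, h1, h2⟩ := S.exists_consecutive ht
  have hlt : S.center a < S.center b := S.center_strictMono (by rw [Fin.lt_def]; omega)
  -- Once multiplied by the length of the segment, the affine identity applies to `u` and to each
  -- hat; at the two end knots only the hats centred there survive.
  refine mul_left_cancel₀ (sub_pos.2 hlt).ne' ?_
  rw [hu a b hab t h1 h2, Finset.mul_sum]
  have : ∀ l, (S.center b - S.center a) * (S.hatAt l t * u (S.center l)) =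
      (S.center b - t) * ((if l = a then 1 else 0) * u (S.center l)) +
      (t - S.center a) * ((if l = b then 1 else 0) * u (S.center l)) := fun l => by
    rw [← mul_assoc, S.affineOnSegment_hatAt (fun c => S.knot_le_or_ge hab) t h1 h2,
      hatAt_center, hatAt_center]
    ring
  simp_rw [this, Finset.sum_add_distrib, ← Finset.mul_sum]
  simp

theorem sum_hatAt {t : ℝ} (ht : t ∈ Set.Icc (0 : ℝ) 1) : ∑ l, S.hatAt l t = 1 := by
  have := S.sum_hatAt_mul (u := fun _ => 1) (fun a b _ t _ _ => by ring) ht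
  simpa using this

theorem hatAt_nonneg (l : Fin S.size) (t : ℝ) : 0 ≤ S.hatAt l t := hat_nonneg _ _ _ _

/-- The function `|· - center j|` is affine between knots, hence interpolated exactly; the triangle
inequality through `center j` costs the factor 2. Closeness to a single knot thus suffices, however
far away the next knot is. -/
theorem sum_hatAt_mul_abs_sub_le {t : ℝ} (ht : t ∈ Set.Icc (0 : ℝ) 1) (j : Fin S.size) :
    ∑ l, S.hatAt l t * |S.center l - t| ≤ 2 * |S.center j - t| := by
  have h1 := S.sum_hatAt_mul (u := fun s => |s - S.center j|)
    (fun a b hab => affineOnSegment_abs_sub (S.knot_le_or_ge hab (S.center_mem_knotSet j))) ht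
  calc ∑ l, S.hatAt l t * |S.center l - t|
      ≤ ∑ l, (S.hatAt l t * |S.center l - S.center j| + S.hatAt l t * |S.center j - t|) := by
        refine Finset.sum_le_sum fun l _ => ?_
        rw [← mul_add]
        exact mul_le_mul_of_nonneg_left (abs_sub_le _ _ _) (S.hatAt_nonneg l t)
    _ = 2 * |S.center j - t| := by
        rw [Finset.sum_add_distrib, ← Finset.sum_mul, S.sum_hatAt ht, h1, abs_sub_comm t]
        ring

/-- The hat functions of a subdivision are splines for every finer subdivision. -/
theorem sum_hatAt_mul_hatAt {S S' : Subdivision} (h : S.knotSet ⊆ S'.knotSet) (l : Fin S.size)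
    {t : ℝ} (ht : t ∈ Set.Icc (0 : ℝ) 1) :
    ∑ l', S'.hatAt l' t * S.hatAt l (S'.center l') = S.hatAt l t :=
  S'.sum_hatAt_mul
    (fun _ _ hab => S.affineOnSegment_hatAt fun _ hc => S'.knot_le_or_ge hab (h hc)) ht

end Subdivision

/-! ### Tensorized interpolation -/

theorem exists_gridPoint_eq {ι : Type*} {S S' : ι → Subdivision}
    (h : ∀ i, (S i).knotSet ⊆ (S' i).knotSet) (l : MultiIndex S) :
    ∃ l', gridPoint S' l' = gridPoint S l := by
  have : ∀ i, ∃ j, (S' i).center j = (S i).center (l i) := fun i =>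
    (S' i).exists_center_eq (h i ((S i).center_mem_knotSet _))
      (by have := ((S i).center_mem (l i)).1; linarith)
      (by have := ((S i).center_mem (l i)).2; linarith)
  choose l' hl' using this
  exact ⟨l', funext fun i => Subtype.ext (hl' i)⟩

section Splines

variable {ι : Type*} [Fintype ι]

theorem basisFun_eq_prod (S : ι → Subdivision) (l : MultiIndex S) (t : Cube ι) :
    basisFun S l t = ∏ i, (S i).hatAt (l i) (t i) := rfl

theorem basisFun_nonneg (S : ι → Subdivision) (l : MultiIndex S) (t : Cube ι) :
    0 ≤ basisFun S l t :=
  Finset.prod_nonneg fun _ _ => hat_nonneg _ _ _ _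

theorem continuous_basisFun (S : ι → Subdivision) (l : MultiIndex S) :
    Continuous (basisFun S l) := by
  refine continuous_finsetProd _ fun i _ => ?_
  exact (continuous_hat ((S i).left_lt_center _) ((S i).center_lt_right _)).comp
    (continuous_subtype_val.comp (continuous_apply i))

theorem basisFun_gridPoint (S : ι → Subdivision) (l l' : MultiIndex S) :
    basisFun S l (gridPoint S l') = if l = l' then 1 else 0 := by
  have : ∀ i, (S i).hatAt (l i) (gridPoint S l' i) = if l i = l' i then 1 else 0 :=
    fun i => (S i).hatAt_center _ _
  simp_rw [basisFun_eq_prod, this, Finset.prod_boole, funext_iff]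
  simp

variable [DecidableEq ι]

theorem continuous_spline (S : ι → Subdivision) (α : MultiIndex S → ℝ) :
    Continuous (spline S α) :=
  continuous_finsetSum _ fun l _ => continuous_const.mul (continuous_basisFun S l)

theorem spline_gridPoint (S : ι → Subdivision) (α : MultiIndex S → ℝ) (l : MultiIndex S) :
    spline S α (gridPoint S l) = α l := by
  simp [spline, basisFun_gridPoint]

/-- Distributivity of the product over the sums; it reduces tensorized identities to one-dimensional
ones. -/
theorem sum_prod_hatAt (S : ι → Subdivision) (g : (i : ι) → Fin (S i).size → ℝ) (t : Cube ι) :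
    ∑ l : MultiIndex S, basisFun S l t * ∏ i, g i (l i) =
      ∏ i, ∑ j, (S i).hatAt j (t i) * g i j := by
  rw [Finset.prod_univ_sum, Fintype.piFinset_univ]
  exact Finset.sum_congr rfl fun l _ => by rw [basisFun_eq_prod, Finset.prod_mul_distrib]

theorem sum_basisFun (S : ι → Subdivision) (t : Cube ι) : ∑ l, basisFun S l t = 1 := by
  have := sum_prod_hatAt S (fun _ _ => 1) t
  simpa [(S _).sum_hatAt (t _).2] using this

theorem sum_basisFun_mul_apply (S : ι → Subdivision) (t : Cube ι) (i : ι)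
    (g : Fin (S i).size → ℝ) :
    ∑ l, basisFun S l t * g (l i) = ∑ j, (S i).hatAt j (t i) * g j := by
  classical
  -- Take the factor 1 in all coordinates but `i`: there the hats sum to 1.
  have := sum_prod_hatAt S (Function.update (fun _ _ => 1) i g) t
  have h1 : ∀ l : MultiIndex S,
      ∏ j, (Function.update (fun _ _ => 1) i g : (j : ι) → Fin (S j).size → ℝ) j (l j) =
        g (l i) := fun l => by
    rw [Finset.prod_eq_single i]
    · simp
    · intro j _ hj; simp [hj]
    · simp
  simp_rw [h1] at this
  rw [this, Finset.prod_eq_single i]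
  · simp
  · intro j _ hj; simp [hj, (S j).sum_hatAt (t j).2]
  · simp

/-- The interpolation error at a point whose coordinates are close to knots. -/
theorem abs_proj_sub_le (S : ι → Subdivision) {f : Cube ι → ℝ} {t : Cube ι} {η κ δ : ℝ}
    (hκ : 0 ≤ κ)
    (hf : ∀ l, |f (gridPoint S l) - f t| ≤ η + κ * ∑ i, |(S i).center (l i) - t i|)
    (ht : ∀ i, ∃ j, |(S i).center j - t i| ≤ δ) :
    |proj S f t - f t| ≤ η + κ * (Fintype.card ι * (2 * δ)) := by
  -- The basis functions sum to 1, so the error is a weighted mean of increments of `f`.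
  have h1 : proj S f t - f t = ∑ l, (f (gridPoint S l) - f t) * basisFun S l t := by
    simp_rw [sub_mul, Finset.sum_sub_distrib, ← Finset.mul_sum, sum_basisFun, mul_one]
    rfl
  calc |proj S f t - f t|
      ≤ ∑ l, |(f (gridPoint S l) - f t) * basisFun S l t| := by
        rw [h1]; exact Finset.abs_sum_le_sum_abs _ _
    _ ≤ ∑ l, (η + κ * ∑ i, |(S i).center (l i) - t i|) * basisFun S l t := by
        refine Finset.sum_le_sum fun l _ => ?_
        rw [abs_mul, abs_of_nonneg (basisFun_nonneg S l t)]
        exact mul_le_mul_of_nonneg_right (hf l) (basisFun_nonneg S l t)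
    _ = η + κ * ∑ i, ∑ j, (S i).hatAt j (t i) * |(S i).center j - t i| := by
        simp_rw [add_mul, Finset.sum_add_distrib, ← Finset.mul_sum, sum_basisFun, mul_one,
          mul_assoc, ← Finset.mul_sum, Finset.sum_mul]
        rw [Finset.sum_comm]
        congr 2
        refine Finset.sum_congr rfl fun i _ => ?_
        rw [← sum_basisFun_mul_apply S t i fun j => |(S i).center j - t i|]
        exact Finset.sum_congr rfl fun l _ => mul_comm _ _
    _ ≤ η + κ * ∑ _i : ι, 2 * δ := by
        gcongr with i
        obtain ⟨j, hj⟩ := ht i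
        exact ((S i).sum_hatAt_mul_abs_sub_le (t i).2 j).trans (by linarith)
    _ = _ := by simp

/-- A spline is reproduced by the projection on a finer subdivision. -/
theorem proj_spline_of_subset {S S' : ι → Subdivision}
    (h : ∀ i, (S i).knotSet ⊆ (S' i).knotSet) (α : MultiIndex S → ℝ) :
    proj S' (spline S α) = spline S α := by
  have key : ∀ l t, ∑ l', basisFun S' l' t * basisFun S l (gridPoint S' l') = basisFun S l t := by
    intro l t
    have := sum_prod_hatAt S' (fun i j => (S i).hatAt (l i) ((S' i).center j)) t
    simp_rw [Subdivision.sum_hatAt_mul_hatAt (h _) _ (t _).2] at this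
    exact this
  funext t
  calc proj S' (spline S α) t
      = ∑ l', (∑ l, α l * basisFun S l (gridPoint S' l')) * basisFun S' l' t := rfl
    _ = ∑ l, α l * ∑ l', basisFun S' l' t * basisFun S l (gridPoint S' l') := by
        simp_rw [Finset.sum_mul, Finset.mul_sum]
        rw [Finset.sum_comm]
        exact Finset.sum_congr rfl fun l _ => Finset.sum_congr rfl fun l' _ => by ring
    _ = spline S α t := by simp_rw [key]; rfl

theorem proj_congr (S : ι → Subdivision) {f g : Cube ι → ℝ}
    (h : ∀ l, f (gridPoint S l) = g (gridPoint S l)) : proj S f = proj S g := by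
  simp only [proj, h]

/-- A projection sees only the values at its knots, and the coarse knots are also fine knots, where
`proj S' f` agrees with `f`. -/
theorem proj_proj_of_subset {S S' : ι → Subdivision}
    (h : ∀ i, (S i).knotSet ⊆ (S' i).knotSet) (f : Cube ι → ℝ) :
    proj S (proj S' f) = proj S f := by
  refine proj_congr S fun l => ?_
  obtain ⟨l', hl'⟩ := exists_gridPoint_eq h l
  rw [← hl']
  exact spline_gridPoint _ _ _

end Splines

/-! ### The multiaffine extension -/

namespace AxisSet

variable (B : AxisSet) (t : Set.Icc (0 : ℝ) 1)

theorem lower_le : B.lower t ≤ t := by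
  have hc : IsCompact {u | u ∈ B.carrier ∧ u ≤ t} :=
    (B.isClosed.inter isClosed_Iic).isCompact
  exact (hc.sSup_mem ⟨0, B.zero_mem, t.2.1⟩).2

theorem le_upper : t ≤ B.upper t := by
  have hc : IsCompact {u | u ∈ B.carrier ∧ t ≤ u} :=
    (B.isClosed.inter isClosed_Ici).isCompact
  exact (hc.sInf_mem ⟨1, B.one_mem, t.2.2⟩).2

variable {t} in
theorem le_lower_or_upper_le {u : Set.Icc (0 : ℝ) 1} (hu : u ∈ B.carrier) :
    u ≤ B.lower t ∨ B.upper t ≤ u :=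
  (le_total u t).imp (fun h => le_sSup ⟨hu, h⟩) fun h => sInf_le ⟨hu, h⟩

variable {t} in
theorem nbr_of_mem (ht : t ∈ B.carrier) (e : Bool) : B.nbr e t = t := by
  have h1 := B.lower_le t
  have h2 := B.le_upper t
  cases e
  · exact le_antisymm h1 (le_sSup ⟨ht, le_rfl⟩)
  · exact le_antisymm (sInf_le ⟨ht, le_rfl⟩) h2

theorem weight_nonneg (e : Bool) : 0 ≤ B.weight e t := by
  have h1 : (B.lower t : ℝ) ≤ t := B.lower_le t
  have h2 : (t : ℝ) ≤ B.upper t := B.le_upper t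
  cases e
  · simp only [weight]
    exact sub_nonneg.2 (div_le_one_of_le₀ (by linarith) (by linarith))
  · simp only [weight]
    exact div_nonneg (by linarith) (by linarith)

theorem sum_weight : ∑ e, B.weight e t = 1 := by
  simp [weight]

/-- The weighted mean of an affine function at the neighbours of `t` is its value at `t`. -/
theorem sum_weight_mul {u : ℝ → ℝ} (hu : AffineOnSegment u (B.lower t) (B.upper t)) :
    ∑ e, B.weight e t * u (B.nbr e t) = u t := by
  have h1 : (B.lower t : ℝ) ≤ t := B.lower_le t
  have h2 : (t : ℝ) ≤ B.upper t := B.le_upper t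
  have h := hu t h1 h2
  simp only [Fintype.sum_bool, weight, nbr, if_true, Bool.false_eq_true, if_false]
  -- If the two neighbours coincide, division by zero gives the weights 0 and 1.
  rcases (h1.trans h2).eq_or_lt with h0 | h0
  · have : (t : ℝ) = B.lower t := le_antisymm (h2.trans h0.ge) h1
    rw [this, ← h0]
    simp
  · have h3 : (B.upper t : ℝ) - B.lower t ≠ 0 := (sub_pos.2 h0).ne'
    field_simp
    linarith

end AxisSet

section KnotsIn

variable {ι : Type*} {F : ι → AxisSet}

/-- The knots of `S` in `[0,1]` belong to `F`. -/
def KnotsIn (F : ι → AxisSet) (S : ι → Subdivision) : Prop := ∀ i l, (S i).point l ∈ (F i).carrier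

theorem KnotsIn.gridPoint_mem {S : ι → Subdivision} (hS : KnotsIn F S) (l : MultiIndex S) :
    gridPoint S l ∈ prodSet F := fun i => hS i (l i)

/-- The auxiliary knots -1 and 2 are not in `F`, so knots outside `(0, 1)` are treated by comparison
with the endpoints. -/
theorem KnotsIn.le_lower_or_upper_le {S : ι → Subdivision} (hS : KnotsIn F S) (i : ι)
    (t : Set.Icc (0 : ℝ) 1) {c : ℝ} (hc : c ∈ (S i).knotSet) :
    c ≤ (F i).lower t ∨ ((F i).upper t : ℝ) ≤ c := by
  rcases le_or_gt c 0 with h0 | h0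
  · exact .inl (h0.trans ((F i).lower t).2.1)
  rcases le_or_gt 1 c with h1 | h1
  · exact .inr (((F i).upper t).2.2.trans h1)
  obtain ⟨l, rfl⟩ := (S i).exists_center_eq hc (by linarith) (by linarith)
  exact (F i).le_lower_or_upper_le (hS i l)

end KnotsIn

section Extension

variable {ι : Type*} [Fintype ι] [DecidableEq ι] (F : ι → AxisSet)

theorem sum_prod_weight (g : (i : ι) → Bool → ℝ) (t : Cube ι) :
    ∑ e : ι → Bool, (∏ j, (F j).weight (e j) (t j)) * ∏ j, g j (e j) =
      ∏ j, ∑ e, (F j).weight e (t j) * g j e := by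
  rw [Finset.prod_univ_sum, Fintype.piFinset_univ]
  exact Finset.sum_congr rfl fun l _ => by rw [Finset.prod_mul_distrib]

theorem sum_weights (t : Cube ι) : ∑ e : ι → Bool, ∏ j, (F j).weight (e j) (t j) = 1 := by
  have := sum_prod_weight F (fun _ _ => 1) t
  simp only [Finset.prod_const_one, mul_one, AxisSet.sum_weight] at this
  exact this

variable {F} in
theorem multiaffineExt_of_mem (f : prodSet F → ℝ) {t : Cube ι} (ht : t ∈ prodSet F) :
    multiaffineExt F f t = f ⟨t, ht⟩ := by
  have h : ∀ e : ι → Bool, (⟨fun j => (F j).nbr (e j) (t j),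
      fun j => (F j).nbr_mem (e j) (t j)⟩ : prodSet F) = ⟨t, ht⟩ := fun e =>
    Subtype.ext (funext fun j => (F j).nbr_of_mem (ht j) _)
  simp_rw [multiaffineExt, h, ← Finset.sum_mul, sum_weights, one_mul]

/-- The weights are nonnegative and sum to 1, so the extension only averages values on `F`. -/
theorem abs_multiaffineExt_sub_le {f g : prodSet F → ℝ} {B : ℝ} (h : ∀ t, |f t - g t| ≤ B)
    (t : Cube ι) : |multiaffineExt F f t - multiaffineExt F g t| ≤ B := by
  simp_rw [multiaffineExt, ← Finset.sum_sub_distrib, ← mul_sub]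
  refine (Finset.abs_sum_le_sum_abs _ _).trans ?_
  rw [← one_mul B, ← sum_weights F t, Finset.sum_mul]
  refine Finset.sum_le_sum fun e _ => ?_
  have h0 : 0 ≤ ∏ j, (F j).weight (e j) (t j) :=
    Finset.prod_nonneg fun _ _ => AxisSet.weight_nonneg _ _ _
  rw [abs_mul, abs_of_nonneg h0]
  exact mul_le_mul_of_nonneg_left (h _) h0

variable {F}

/-- Splines with knots in `F` are reproduced by the multiaffine extension. -/
theorem multiaffineExt_spline {S : ι → Subdivision} (hS : KnotsIn F S) (α : MultiIndex S → ℝ) :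
    multiaffineExt F (fun t => spline S α t.1) = spline S α := by
  have key : ∀ l t, ∑ e : ι → Bool, (∏ j, (F j).weight (e j) (t j)) *
      basisFun S l (fun j => (F j).nbr (e j) (t j)) = basisFun S l t := by
    intro l t
    have := sum_prod_weight F (fun i e => (S i).hatAt (l i) ((F i).nbr e (t i))) t
    simp_rw [AxisSet.sum_weight_mul _ _ ((S _).affineOnSegment_hatAt
      fun c => hS.le_lower_or_upper_le _ _)] at this
    exact this
  funext t
  simp_rw [multiaffineExt, spline, Finset.mul_sum]
  rw [Finset.sum_comm]
  refine Finset.sum_congr rfl fun l _ => ?_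
  rw [← key l t, Finset.mul_sum]
  exact Finset.sum_congr rfl fun e _ => by ring

/-- The distance between the projection and the multiaffine extension is attained on `F`. -/
theorem abs_proj_sub_multiaffineExt_le {S : ι → Subdivision} (hS : KnotsIn F S) {f : Cube ι → ℝ}
    {B : ℝ} (h : ∀ t ∈ prodSet F, |proj S f t - f t| ≤ B) (t : Cube ι) :
    |proj S f t - multiaffineExt F (fun t => f t.1) t| ≤ B := by
  -- The spline `proj S f` is its own extension, so the difference is one of two extensions.
  have h1 := abs_multiaffineExt_sub_le F (f := fun t => proj S f t.1) (g := fun t => f t.1)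
    (fun t => h t.1 t.2) t
  rwa [proj, multiaffineExt_spline hS] at h1

theorem proj_multiaffineExt {S : ι → Subdivision} (hS : KnotsIn F S) (f : Cube ι → ℝ) :
    proj S (multiaffineExt F fun t => f t.1) = proj S f :=
  proj_congr S fun l => multiaffineExt_of_mem _ (hS.gridPoint_mem l)

end Extension

section KnotClosure

variable {ι : Type*} {m₀ : ℕ} {S : ℕ → ι → Subdivision}

theorem knotSet_subset_of_le (hS : ∀ m ≥ m₀, ∀ i, (S m i).knotSet ⊆ (S (m + 1) i).knotSet)
    {m p : ℕ} (hm : m₀ ≤ m) (hmp : m ≤ p) (i : ι) : (S m i).knotSet ⊆ (S p i).knotSet := by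
  induction p, hmp using Nat.le_induction with
  | base => exact subset_rfl
  | succ p hp ih => exact ih.trans (hS p (hm.trans hp) i)

theorem knotsIn_knotClosure {m : ℕ} (hm : m₀ ≤ m) : KnotsIn (knotClosure m₀ S) (S m) :=
  fun i l => subset_closure (Set.mem_biUnion hm ((S m i).center_mem_knotSet l))

/-- The knots are eventually uniformly close to the points of the closure. -/
theorem exists_forall_exists_center_near [Finite ι]
    (hS : ∀ m ≥ m₀, ∀ i, (S m i).knotSet ⊆ (S (m + 1) i).knotSet) {δ : ℝ} (hδ : 0 < δ) :
    ∃ M ≥ m₀, ∀ m ≥ M, ∀ i, ∀ t ∈ (knotClosure m₀ S i).carrier,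
      ∃ j, |(S m i).center j - t| ≤ δ := by
  have h1 : ∀ i, ∃ M ≥ m₀, ∀ t ∈ (knotClosure m₀ S i).carrier, ∃ j, |(S M i).center j - t| < δ := by
    intro i
    -- These open sets increase with the level and cover the compact `F_i`, so one of them contains
    -- it.
    let O : ℕ → Set (Set.Icc (0 : ℝ) 1) := fun k => {t | ∃ j, |(S (m₀ + k) i).center j - t| < δ}
    have hmono : Monotone O := by
      rintro a b hab t ⟨j, hj⟩
      obtain ⟨j', hj'⟩ := (S (m₀ + b) i).exists_center_eq
        (knotSet_subset_of_le hS (Nat.le_add_right m₀ a) (Nat.add_le_add_left hab m₀) i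
          ((S (m₀ + a) i).center_mem_knotSet j))
        (by have := ((S (m₀ + a) i).center_mem j).1; linarith)
        (by have := ((S (m₀ + a) i).center_mem j).2; linarith)
      exact ⟨j', by rwa [hj']⟩
    obtain ⟨k, hk⟩ := (knotClosure m₀ S i).isClosed.isCompact.elim_directed_cover O
      (fun k => by
        simp only [O, Set.ofPred_exists]
        exact isOpen_iUnion fun j => isOpen_lt (by fun_prop) continuous_const)
      (fun t ht => by
        -- A radius of at most 1 keeps the approximating knot inside `(-1, 2)`, so it is a centre.
        obtain ⟨c, hc, hct⟩ := Metric.mem_closure_iff.1 ht (min δ 1) (lt_min hδ one_pos)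
        simp only [Set.mem_iUnion] at hc
        obtain ⟨m, hm, hc⟩ := hc
        rw [Real.dist_eq, abs_sub_comm, lt_min_iff] at hct
        have h2 := abs_lt.1 hct.2
        have h3 := t.2.1
        have h4 := t.2.2
        obtain ⟨j, rfl⟩ := (S m i).exists_center_eq hc (by linarith) (by linarith)
        refine Set.mem_iUnion.2 ⟨m - m₀, ?_⟩
        simp only [O, Set.mem_ofPred_eq]
        rw [Nat.add_sub_cancel' hm]
        exact ⟨j, hct.1⟩)
      hmono.directed_le
    exact ⟨m₀ + k, Nat.le_add_right _ _, fun t ht => hk ht⟩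
  choose N hN0 hN using h1
  obtain ⟨M, hM⟩ := (Set.finite_range N).bddAbove
  refine ⟨max M m₀, le_max_right _ _, fun m hm i t ht => ?_⟩
  obtain ⟨j, hj⟩ := hN i t ht
  obtain ⟨j', hj'⟩ := (S m i).exists_center_eq
    (knotSet_subset_of_le hS (hN0 i)
      ((hM (Set.mem_range_self i)).trans ((le_max_left _ _).trans hm)) i
      ((S (N i) i).center_mem_knotSet j))
    (by have := ((S (N i) i).center_mem j).1; linarith)
    (by have := ((S (N i) i).center_mem j).2; linarith)
  exact ⟨j', by rw [hj']; exact hj.le⟩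

end KnotClosure

/-! ### Reproducing kernel Hilbert spaces -/

namespace CovKernel

open scoped InnerProductSpace

variable {X Y : Type*} (k : CovKernel X)

/-- The element `k(·, x)` of the reproducing kernel Hilbert space. -/
noncomputable def kernelSection (x : X) : k.Space := RKHS.kerFun k.Space x 1

theorem inner_kernelSection (f : k.Space) (x : X) : ⟪f, k.kernelSection x⟫_ℝ = f x := by
  simp [kernelSection]

theorem kernelSection_apply (x y : X) : k.kernelSection y x = k.toFun x y := by
  rw [kernelSection, RKHS.kerFun_apply, RKHS.OfKernel.kernel_ofKernel]
  simp [op]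

theorem toFun_comm (x y : X) : k.toFun x y = k.toFun y x := by
  simpa using k.posSemidef.1.apply y x

theorem norm_kernelSection_sub_sq (x y : X) :
    ‖k.kernelSection x - k.kernelSection y‖ ^ 2 = k.toFun x x - 2 * k.toFun x y + k.toFun y y := by
  rw [norm_sub_sq_real, ← real_inner_self_eq_norm_sq, ← real_inner_self_eq_norm_sq]
  simp_rw [inner_kernelSection, kernelSection_apply]
  rw [k.toFun_comm y x]

/-- Reproducing property and Cauchy–Schwarz: elements of a ball share the modulus of continuity of
`x ↦ k(·, x)`. -/
theorem abs_apply_sub_le (f : k.Space) (x y : X) :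
    |f x - f y| ≤ ‖f‖ * ‖k.kernelSection x - k.kernelSection y‖ := by
  rw [← inner_kernelSection, ← inner_kernelSection, ← inner_sub_right]
  exact abs_real_inner_le_norm _ _

/-- Finite combinations of kernel sections. -/
noncomputable def comb : (X →₀ ℝ) →ₗ[ℝ] k.Space := Finsupp.linearCombination ℝ k.kernelSection

theorem inner_comb (f : k.Space) (c : X →₀ ℝ) : ⟪f, k.comb c⟫_ℝ = c.sum fun x a => a * f x := by
  rw [comb, Finsupp.linearCombination_apply, Finsupp.inner_sum]
  simp_rw [inner_smul_right, inner_kernelSection]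

theorem denseRange_comb : DenseRange k.comb := by
  have h := RKHS.kerFun_dense k.Space
  rw [← Submodule.dense_iff_topologicalClosure_eq_top] at h
  refine h.mono ?_
  change _ ⊆ ((LinearMap.range k.comb : Submodule ℝ k.Space) : Set k.Space)
  rw [SetLike.coe_subset_coe, Submodule.span_le]
  rintro _ ⟨x, v, rfl⟩
  refine ⟨Finsupp.single x v, ?_⟩
  rw [comb, Finsupp.linearCombination_single, kernelSection, ← map_smul]
  simp

/-- Both squared norms are the same quadratic form in the kernel values; this makes the extension
operator isometric. -/
theorem norm_comb_comap (g : Y → X) (c : Y →₀ ℝ) :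
    ‖k.comb (c.mapDomain g)‖ = ‖(k.comap g).comb c‖ := by
  have h1 : ∀ y, k.comb (c.mapDomain g) (g y) = (k.comap g).comb c y := by
    intro y
    rw [← inner_kernelSection, ← inner_kernelSection, real_inner_comm,
      real_inner_comm _ ((k.comap g).comb c), inner_comb, inner_comb, Finsupp.sum_mapDomain_index (by simp) (by intros; ring)]
    simp_rw [kernelSection_apply]
    rfl
  rw [← sq_eq_sq₀ (norm_nonneg _) (norm_nonneg _), ← real_inner_self_eq_norm_sq,
    ← real_inner_self_eq_norm_sq, inner_comb, inner_comb,
    Finsupp.sum_mapDomain_index (by simp) (by intros; ring)]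
  simp_rw [h1]

/-- The isometric extension operator from the space of a pulled back kernel. -/
theorem exists_isometric_extension (g : Y → X) :
    ∃ E : (k.comap g).Space →L[ℝ] k.Space, (∀ f, ‖E f‖ = ‖f‖) ∧ ∀ f y, E f (g y) = f y := by
  let φ : (Y →₀ ℝ) →ₗ[ℝ] k.Space := k.comb ∘ₗ Finsupp.lmapDomain ℝ ℝ g
  have hφ : ∀ c, ‖φ c‖ = ‖(k.comap g).comb c‖ := k.norm_comb_comap g
  have hd := (k.comap g).denseRange_comb
  -- Continuous extension, from the dense finite combinations, of the map sending the section at `y`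
  -- to the section at `g y`.
  let E := φ.extendOfNorm (k.comap g).comb
  have hE : ∀ c, E ((k.comap g).comb c) = φ c :=
    LinearMap.extendOfNorm_eq hd ⟨1, fun c => by rw [hφ, one_mul]⟩
  have hnorm : ∀ f, ‖E f‖ = ‖f‖ := by
    intro f
    refine hd.induction_on (p := fun f => ‖E f‖ = ‖f‖) f
      (isClosed_eq (by fun_prop) (by fun_prop)) fun c => ?_
    rw [hE, hφ]
  refine ⟨E, hnorm, fun f y => ?_⟩
  have hinner : ∀ f f', ⟪E f, E f'⟫_ℝ = ⟪f, f'⟫_ℝ :=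
    (LinearMap.norm_map_iff_inner_map_map (𝕜 := ℝ) E).1 hnorm
  have h1 : E ((k.comap g).kernelSection y) = k.kernelSection (g y) := by
    have := hE (Finsupp.single y 1)
    simpa [φ, comb] using this
  rw [← inner_kernelSection, ← h1, hinner, inner_kernelSection]

/-- Restriction of functions is a contraction between reproducing kernel Hilbert spaces. -/
theorem exists_restriction (g : Y → X) :
    ∃ R : k.Space →L[ℝ] (k.comap g).Space, (∀ f, ‖R f‖ ≤ ‖f‖) ∧ ∀ f y, R f y = f (g y) := by
  obtain ⟨E, hE, hEg⟩ := k.exists_isometric_extension g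
  -- The two known properties of `E` already force this: the squared distance expands to `k - 2k + k
  -- = 0`.
  have h1 : ∀ y, E ((k.comap g).kernelSection y) = k.kernelSection (g y) := by
    have hinner : ∀ f f', ⟪E f, E f'⟫_ℝ = ⟪f, f'⟫_ℝ :=
      (LinearMap.norm_map_iff_inner_map_map (𝕜 := ℝ) E).1 hE
    intro y
    rw [← sub_eq_zero, ← norm_eq_zero, ← sq_eq_zero_iff, norm_sub_sq_real, inner_kernelSection, hEg,
      hE, ← real_inner_self_eq_norm_sq, ← real_inner_self_eq_norm_sq, inner_kernelSection,
      inner_kernelSection, kernelSection_apply, kernelSection_apply]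
    change k.toFun (g y) (g y) - 2 * k.toFun (g y) (g y) + k.toFun (g y) (g y) = 0
    ring
  -- Restriction is the adjoint of the isometric extension.
  refine ⟨E.adjoint, fun f => ?_, fun f y => ?_⟩
  · refine (E.adjoint.le_opNorm f).trans ?_
    rw [LinearIsometryEquiv.norm_map]
    refine mul_le_of_le_one_left (norm_nonneg _) (E.opNorm_le_bound zero_le_one fun f => ?_)
    rw [hE, one_mul]
  · rw [← inner_kernelSection, ContinuousLinearMap.adjoint_inner_left, h1, inner_kernelSection]

/-- The interpolant of least norm at finitely many points with invertible kernel matrix. -/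
theorem exists_minNorm_interpolant {κ : Type*} [Fintype κ] [DecidableEq κ] (p : κ → X)
    (K : Matrix κ κ ℝ) (hK : ∀ i j, K i j = k.toFun (p i) (p j)) (hinv : IsUnit K) (α : κ → ℝ) :
    ∃ h : k.Space, (∀ i, h (p i) = α i) ∧ ‖h‖ ^ 2 = α ⬝ᵥ K⁻¹.mulVec α ∧
      ∀ f : k.Space, (∀ i, f (p i) = α i) → ‖h‖ ≤ ‖f‖ := by
  let c := K⁻¹.mulVec α
  let h : k.Space := ∑ j, c j • k.kernelSection (p j)
  have hin : ∀ f : k.Space, ⟪f, h⟫_ℝ = ∑ j, c j * f (p j) := fun f => by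
    simp_rw [h, inner_sum, inner_smul_right, inner_kernelSection]
  have hh : ∀ i, h (p i) = α i := by
    intro i
    rw [← inner_kernelSection, real_inner_comm, hin]
    have h2 : K.mulVec c = α := by
      simp only [c, Matrix.mulVec_mulVec]
      rw [Matrix.mul_nonsing_inv _ ((Matrix.isUnit_iff_isUnit_det K).1 hinv), Matrix.one_mulVec]
    rw [← congrFun h2 i, Matrix.mulVec, dotProduct]
    refine Finset.sum_congr rfl fun j _ => ?_
    rw [kernelSection_apply, hK, k.toFun_comm, mul_comm]
  -- All interpolants of `α` have the same inner product with `h`, so Cauchy–Schwarz yields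
  -- minimality.
  have hf : ∀ f : k.Space, (∀ i, f (p i) = α i) → ⟪f, h⟫_ℝ = α ⬝ᵥ K⁻¹.mulVec α := by
    intro f hf
    rw [hin, dotProduct]
    exact Finset.sum_congr rfl fun j _ => by rw [hf, mul_comm]
  refine ⟨h, hh, ?_, fun f hfα => ?_⟩
  · rw [← real_inner_self_eq_norm_sq, hf h hh]
  · rcases (norm_nonneg h).eq_or_lt with h0 | h0
    · rw [← h0]; exact norm_nonneg f
    · refine le_of_mul_le_mul_right ?_ h0
      rw [← real_inner_self_eq_norm_mul_norm, hf h hh, ← hf f hfα]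
      exact real_inner_le_norm _ _

end CovKernel

/-! ### Constrained least norm problems in Hilbert spaces -/

section LeastNorm

open Filter Topology
open scoped InnerProductSpace

variable {G : Type*} [NormedAddCommGroup G] [InnerProductSpace ℝ G]

/-- Least norm elements of a convex set satisfy the projection inequality. -/
theorem IsArgmin.norm_sq_add_le {A : Set G} (hA : Convex ℝ A) {a : G}
    (ha : IsArgmin A (fun f => ‖f‖) a) {f : G} (hf : f ∈ A) :
    ‖a‖ ^ 2 + ‖f - a‖ ^ 2 ≤ ‖f‖ ^ 2 := by
  have h1 : ‖(0 : G) - a‖ = ⨅ w : A, ‖(0 : G) - w‖ := by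
    have : Nonempty A := ⟨⟨a, ha.1⟩⟩
    refine le_antisymm (le_ciInf fun w => ?_)
      (ciInf_le (f := fun w : A => ‖(0 : G) - w‖) ⟨0, Set.forall_mem_range.2 fun _ => norm_nonneg _⟩
        ⟨a, ha.1⟩)
    simpa using ha.2 w.2
  have h2 := (norm_eq_iInf_iff_real_inner_le_zero hA ha.1).1 h1 f hf
  have h3 : f = a + (f - a) := by abel
  rw [zero_sub, inner_neg_left] at h2
  conv_rhs => rw [h3, norm_add_sq_real]
  linarith

theorem IsArgmin.unique {A : Set G} (hA : Convex ℝ A) {a b : G}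
    (ha : IsArgmin A (fun f => ‖f‖) a) (hb : IsArgmin A (fun f => ‖f‖) b) : a = b := by
  have h1 := ha.norm_sq_add_le hA hb.1
  have h2 := hb.norm_sq_add_le hA ha.1
  have h3 : ‖b - a‖ ^ 2 = 0 := by
    have := sq_nonneg ‖b - a‖
    have := sq_nonneg ‖a - b‖
    linarith
  rw [sq_eq_zero_iff, norm_eq_zero, sub_eq_zero] at h3
  exact h3.symm

theorem exists_isArgmin_norm [CompleteSpace G] {A : Set G} (hne : A.Nonempty) (hcl : IsClosed A)
    (hA : Convex ℝ A) : ∃ a, IsArgmin A (fun f => ‖f‖) a := by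
  obtain ⟨a, ha, h⟩ := exists_norm_eq_iInf_of_complete_convex hne hcl.isComplete hA 0
  refine ⟨a, ha, fun f hf => ?_⟩
  have : ‖(0 : G) - a‖ ≤ ‖(0 : G) - f‖ := by
    rw [h]
    exact ciInf_le (f := fun w : A => ‖(0 : G) - w‖)
      ⟨0, Set.forall_mem_range.2 fun _ => norm_nonneg _⟩ ⟨f, hf⟩
  simpa using this

/-- A bounded real sequence which is asymptotically nondecreasing is Cauchy. -/
theorem cauchySeq_of_almost_monotone {ν : ℕ → ℝ} {B : ℝ} (hB : ∀ᶠ m in atTop, |ν m| ≤ B)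
    (h : ∀ ε > 0, ∃ M, ∀ m ≥ M, ∀ p ≥ m, ν m ≤ ν p + ε) : CauchySeq ν := by
  have hb1 : IsBoundedUnder (· ≤ ·) atTop ν := ⟨B, by
    simpa using hB.mono fun m hm => (abs_le.1 hm).2⟩
  have hb2 : IsBoundedUnder (· ≥ ·) atTop ν := ⟨-B, by
    simpa using hB.mono fun m hm => (abs_le.1 hm).1⟩
  have key : limsup ν atTop ≤ liminf ν atTop := by
    refine le_of_forall_pos_le_add fun ε hε => ?_
    obtain ⟨M, hM⟩ := h ε hε
    refine limsup_le_of_le hb2.isCoboundedUnder_le ((eventually_ge_atTop M).mono fun m hm => ?_)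
    have : ν m - ε ≤ liminf ν atTop :=
      le_liminf_of_le hb1.isCoboundedUnder_ge
        ((eventually_ge_atTop m).mono fun p hp => by linarith [hM m hm p hp])
    linarith
  exact (tendsto_of_le_liminf_of_limsup_le le_rfl key hb1 hb2).cauchySeq

variable {W V : Type*} [NormedAddCommGroup W] [NormedSpace ℝ W] [NormedAddCommGroup V]
  [NormedSpace ℝ V]

/-- The `f` such that `T f` satisfies the constraint `C` and the equation `ev (T f) = y`. -/
def feasibleSet (T : G →L[ℝ] W) (C : Set W) (ev : W →L[ℝ] V) (y : V) : Set G :=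
  {f | T f ∈ C ∧ ev (T f) = y}

theorem convex_feasibleSet (T : G →L[ℝ] W) {C : Set W} (hC : Convex ℝ C) (ev : W →L[ℝ] V) (y : V) :
    Convex ℝ (feasibleSet T C ev y) := by
  intro f hf g hg a b ha hb hab
  refine ⟨?_, ?_⟩
  · rw [map_add, map_smul, map_smul]
    exact hC hf.1 hg.1 ha hb hab
  · rw [map_add, map_smul, map_smul, map_add, map_smul, map_smul, hf.2, hg.2, ← add_smul, hab,
      one_smul]

theorem isClosed_feasibleSet (T : G →L[ℝ] W) {C : Set W} (hC : IsClosed C) (ev : W →L[ℝ] V)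
    (y : V) : IsClosed (feasibleSet T C ev y) :=
  (hC.preimage T.continuous).inter
    (isClosed_eq (ev.continuous.comp T.continuous) continuous_const)

/-- Operators that converge to a surjective operator onto a finite-dimensional space have uniformly
bounded right inverses. -/
theorem exists_bounded_preimage [FiniteDimensional ℝ V] {L : ℕ → G →L[ℝ] V} {L' : G →L[ℝ] V}
    (hL : Tendsto L atTop (𝓝 L')) (hsurj : Function.Surjective L') :
    ∃ c > 0, ∀ᶠ m in atTop, ∀ z, ∃ w, L m w = z ∧ ‖w‖ ≤ c * ‖z‖ := by
  obtain ⟨R₀, hR₀⟩ := LinearMap.exists_rightInverse_of_surjective (L' : G →ₗ[ℝ] V)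
    (LinearMap.range_eq_top.2 hsurj)
  let R : V →L[ℝ] G := LinearMap.toContinuousLinearMap R₀
  have hR : ∀ z, L' (R z) = z := fun z => LinearMap.congr_fun hR₀ z
  -- For large `m`, `L m ∘ R` is within 1/2 of the identity, so its inverse has norm at most 2.
  refine ⟨2 * (‖R‖ + 1), by positivity, ?_⟩
  have h1 : ∀ᶠ m in atTop, ‖L m - L'‖ * (‖R‖ + 1) < 1 / 2 := by
    have h := ((tendsto_iff_norm_sub_tendsto_zero.1 hL).mul_const (‖R‖ + 1))
    rw [zero_mul] at h
    exact h.eventually (gt_mem_nhds (by norm_num))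
  filter_upwards [h1] with m hm z
  let A : V →ₗ[ℝ] V := ((L m).comp R : V →L[ℝ] V)
  have hA : ∀ v, ‖v‖ ≤ 2 * ‖A v‖ := by
    intro v
    have e1 : A v = v + (L m - L') (R v) := by
      simp [A, hR]
    have e2 : ‖(L m - L') (R v)‖ ≤ 1 / 2 * ‖v‖ := by
      calc ‖(L m - L') (R v)‖ ≤ ‖L m - L'‖ * (‖R‖ * ‖v‖) :=
            ((L m - L').le_opNorm _).trans (by gcongr; exact R.le_opNorm v)
        _ ≤ (‖L m - L'‖ * (‖R‖ + 1)) * ‖v‖ := by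
            rw [mul_assoc]; gcongr; linarith
        _ ≤ 1 / 2 * ‖v‖ := by gcongr
    have e3 : ‖v‖ ≤ ‖A v‖ + ‖(L m - L') (R v)‖ := by
      have : v = A v - (L m - L') (R v) := by rw [e1]; abel
      calc ‖v‖ = ‖A v - (L m - L') (R v)‖ := by rw [← this]
        _ ≤ _ := norm_sub_le _ _
    linarith
  have hinj : Function.Injective A := by
    rw [injective_iff_map_eq_zero]
    intro v hv
    have := hA v
    rw [hv, norm_zero, mul_zero] at this
    exact norm_le_zero_iff.1 this
  obtain ⟨v, hv⟩ := LinearMap.injective_iff_surjective.1 hinj z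
  refine ⟨R v, hv, ?_⟩
  calc ‖R v‖ ≤ ‖R‖ * ‖v‖ := R.le_opNorm v
    _ ≤ (‖R‖ + 1) * (2 * ‖z‖) := by
        have := hA v
        rw [hv] at this
        gcongr
        linarith
    _ = _ := by ring

variable {T : ℕ → G →L[ℝ] W} {T' : G →L[ℝ] W} {C : Set W} {ev : W →L[ℝ] V} {y : V} {m₀ : ℕ}

/-- Elements that almost satisfy the interpolation equation are close to feasible ones. -/
theorem exists_feasible_near [FiniteDimensional ℝ V] (hT : Tendsto T atTop (𝓝 T'))
    (hC : Convex ℝ C) (hproj : ∀ m ≥ m₀, ∀ f, T' f ∈ C → T m f ∈ C)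
    {g₀ : G} {r : ℝ} (hr : 0 < r) (hball : ∀ w, ‖w‖ < r → T' (g₀ + w) ∈ C)
    (hg₀ : ev (T' g₀) = y) (hsurj : Function.Surjective fun f => ev (T' f))
    (B : ℝ) {ε : ℝ} (hε : 0 < ε) :
    ∃ M ≥ m₀, ∃ δ > 0, ∀ m ≥ M, ∀ f, ‖f‖ ≤ B → T m f ∈ C → ‖ev (T m f) - y‖ ≤ δ →
      ∃ f' ∈ feasibleSet (T m) C ev y, ‖f' - f‖ ≤ ε := by
  have hL : Tendsto (fun m => ev.comp (T m)) atTop (𝓝 (ev.comp T')) :=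
    ((ContinuousLinearMap.compL ℝ G W V ev).continuous.tendsto T').comp hT
  obtain ⟨c, hc, hc'⟩ := exists_bounded_preimage hL hsurj
  -- `Q` bounds `‖g₀ + w - f‖` for `‖w‖ < r`; a mixing weight `s` with `s * Q ≤ ε` then moves `f` by
  -- at most `ε`.
  set Q : ℝ := |B| + ‖g₀‖ + r with hQ
  have hQ0 : 0 < Q := by positivity
  obtain ⟨s, hs0, hs1, hsε⟩ : ∃ s : ℝ, 0 < s ∧ s ≤ 1 ∧ s * Q ≤ ε :=
    ⟨min 1 (ε / Q), lt_min one_pos (by positivity), min_le_left _ _, by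
      calc min 1 (ε / Q) * Q ≤ ε / Q * Q := by gcongr; exact min_le_right _ _
        _ = ε := div_mul_cancel₀ _ hQ0.ne'⟩
  have hg : Tendsto (fun m => ‖y - ev (T m g₀)‖) atTop (𝓝 0) := by
    have h := tendsto_const_nhds (x := y).sub
      ((ev.continuous.tendsto _).comp (((ContinuousLinearMap.apply ℝ W g₀).continuous.tendsto
        T').comp hT))
    have h' := h.norm
    simp only [ContinuousLinearMap.apply_apply, hg₀, sub_self, norm_zero] at h'
    exact h'
  obtain ⟨M, hM⟩ := eventually_atTop.1 ((hc'.and (hg.eventually (gt_mem_nhds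
    (show (0 : ℝ) < r / (4 * c) by positivity)))).and (eventually_ge_atTop m₀))
  refine ⟨max M m₀, le_max_right _ _, s * (r / (4 * c)), by positivity, fun m hm f hfB hfC hfy => ?_⟩
  obtain ⟨⟨hpre, hgm⟩, hm0⟩ := hM m ((le_max_left _ _).trans hm)
  -- This right-hand side is what makes `(1 - s) • f + s • (g₀ + w)` interpolate `y` exactly. Each
  -- of its two terms has norm at most `r / (4 * c)`, whence `‖w‖ ≤ r / 2`.
  obtain ⟨w, hw, hwn⟩ := hpre ((y - ev (T m g₀)) - ((1 - s) / s) • (ev (T m f) - y))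
  have hwr : ‖w‖ < r := by
    have h1 : ‖((1 - s) / s) • (ev (T m f) - y)‖ ≤ r / (4 * c) := by
      rw [norm_smul, Real.norm_eq_abs, abs_of_nonneg (div_nonneg (by linarith) hs0.le)]
      calc (1 - s) / s * ‖ev (T m f) - y‖ ≤ 1 / s * (s * (r / (4 * c))) := by
            gcongr
            linarith
        _ = r / (4 * c) := by field_simp
    calc ‖w‖ ≤ c * (r / (4 * c) + r / (4 * c)) := by
          refine hwn.trans ?_
          gcongr
          exact (norm_sub_le _ _).trans (add_le_add hgm.le h1)
      _ = r / 2 := by field_simp; ring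
      _ < r := by linarith
  refine ⟨(1 - s) • f + s • (g₀ + w), ⟨?_, ?_⟩, ?_⟩
  · rw [map_add, map_smul, map_smul]
    exact hC hfC (hproj m hm0 _ (hball w hwr)) (by linarith) hs0.le (by ring)
  · have hw' : ev (T m w) = (y - ev (T m g₀)) - ((1 - s) / s) • (ev (T m f) - y) := hw
    simp only [map_add, map_smul, smul_add, hw', smul_sub, smul_smul, mul_div_cancel₀ _ hs0.ne']
    module
  · have : (1 - s) • f + s • (g₀ + w) - f = s • (g₀ + w - f) := by module
    rw [this, norm_smul, Real.norm_eq_abs, abs_of_pos hs0]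
    refine le_trans ?_ hsε
    gcongr
    calc ‖g₀ + w - f‖ ≤ ‖g₀‖ + ‖w‖ + ‖f‖ :=
          (norm_sub_le _ _).trans (by gcongr; exact norm_add_le _ _)
      _ ≤ Q := by
          rw [hQ]
          have := le_abs_self B
          linarith

theorem tendsto_clm_apply_of_tendsto {f : ℕ → G} {g : G} (hT : Tendsto T atTop (𝓝 T'))
    (hf : Tendsto f atTop (𝓝 g)) : Tendsto (fun m => T m (f m)) atTop (𝓝 (T' g)) := by
  have : Continuous fun q : (G →L[ℝ] W) × G => q.1 q.2 := by fun_prop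
  exact (this.tendsto (T', g)).comp (hT.prodMk_nhds hf)

/-- The least norm solutions of the approximate problems converge to the least norm solution of the
limit problem. -/
theorem tendsto_isArgmin_feasibleSet [CompleteSpace G] [FiniteDimensional ℝ V]
    (hT : Tendsto T atTop (𝓝 T')) (hC : Convex ℝ C) (hCcl : IsClosed C)
    (hnest : ∀ m ≥ m₀, ∀ p ≥ m, ∀ f, T p f ∈ C → T m f ∈ C)
    (hproj : ∀ m ≥ m₀, ∀ f, T' f ∈ C → T m f ∈ C)
    {g₀ : G} {r : ℝ} (hr : 0 < r) (hball : ∀ w, ‖w‖ < r → T' (g₀ + w) ∈ C)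
    (hg₀ : ev (T' g₀) = y) (hsurj : Function.Surjective fun f => ev (T' f))
    {f : ℕ → G} {f' : G}
    (hf : ∀ m ≥ m₀, IsArgmin (feasibleSet (T m) C ev y) (fun f => ‖f‖) (f m))
    (hf' : IsArgmin (feasibleSet T' C ev y) (fun f => ‖f‖) f') :
    Tendsto f atTop (𝓝 f') := by
  have hL : Tendsto (fun m => ev.comp (T m)) atTop (𝓝 (ev.comp T')) :=
    ((ContinuousLinearMap.compL ℝ G W V ev).continuous.tendsto T').comp hT
  have hconv := fun m => convex_feasibleSet (T m) hC ev y
  -- the norms are eventually almost bounded by the norm of the limit solution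
  have hup : ∀ ε > 0, ∃ M ≥ m₀, ∀ m ≥ M, ‖f m‖ ≤ ‖f'‖ + ε := by
    intro ε hε
    obtain ⟨M, hM0, δ, hδ, hM⟩ := exists_feasible_near hT hC hproj hr hball hg₀ hsurj ‖f'‖ hε
    have hlim : Tendsto (fun m => ev (T m f') - y) atTop (𝓝 0) := by
      have h := (((ContinuousLinearMap.apply ℝ V f').continuous.tendsto _).comp hL).sub_const y
      simp only [ContinuousLinearMap.apply_apply, ContinuousLinearMap.comp_apply, hf'.1.2,
        sub_self] at h
      exact h
    obtain ⟨M', hM'⟩ := eventually_atTop.1 (hlim.norm.eventually (ge_mem_nhds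
      (show ‖(0 : V)‖ < δ by simpa)))
    refine ⟨max M M', hM0.trans (le_max_left _ _), fun m hm => ?_⟩
    have hmM := (le_max_left _ _).trans hm
    obtain ⟨u, hu, hun⟩ := hM m hmM f' le_rfl (hproj m (hM0.trans hmM) _ hf'.1.1)
      (hM' m ((le_max_right _ _).trans hm))
    have h1 : ‖f m‖ ≤ ‖u‖ := (hf m (hM0.trans hmM)).2 hu
    have h2 := norm_le_norm_add_norm_sub' u f'
    linarith
  obtain ⟨M₁, hM₁0, hM₁⟩ := hup 1 one_pos
  set B := ‖f'‖ + 1 with hB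
  have hB1 : 1 ≤ B := by rw [hB]; linarith [norm_nonneg f']
  -- later solutions are close to feasible elements of earlier problems
  have hback : ∀ ε > 0, ∃ M ≥ M₁, ∀ m ≥ M, ∀ p ≥ m,
      ∃ u ∈ feasibleSet (T m) C ev y, ‖u - f p‖ ≤ ε := by
    intro ε hε
    obtain ⟨M, hM0, δ, hδ, hM⟩ := exists_feasible_near hT hC hproj hr hball hg₀ hsurj B hε
    obtain ⟨N, hN⟩ := Metric.cauchySeq_iff.1 hL.cauchySeq (δ / B) (by positivity)
    refine ⟨max (max M M₁) N, (le_max_right _ _).trans (le_max_left _ _), fun m hm p hp => ?_⟩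
    have hmM : M ≤ m := ((le_max_left _ _).trans (le_max_left _ _)).trans hm
    have hmM₁ : M₁ ≤ m := ((le_max_right _ _).trans (le_max_left _ _)).trans hm
    have hmN : N ≤ m := (le_max_right _ _).trans hm
    have hpf := hf p (hM0.trans (hmM.trans hp))
    have hpB := hM₁ p (hmM₁.trans hp)
    refine hM m hmM (f p) hpB (hnest m (hM0.trans hmM) p hp _ hpf.1.1) ?_
    have h1 := hN m hmN p (hmN.trans hp)
    rw [dist_eq_norm] at h1
    -- The minimizer `f p` interpolates exactly for `T p`, so its defect for `T m` is governed by
    -- the operator distance.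
    calc ‖ev (T m (f p)) - y‖ = ‖(ev.comp (T m) - ev.comp (T p)) (f p)‖ := by
          rw [← hpf.1.2]; rfl
      _ ≤ δ / B * B := (ContinuousLinearMap.le_opNorm _ _).trans (by gcongr)
      _ = δ := div_mul_cancel₀ _ (by positivity)
  have hcauchy_norm : CauchySeq fun m => ‖f m‖ := by
    refine cauchySeq_of_almost_monotone (B := B)
      ((eventually_ge_atTop M₁).mono fun m hm => by rw [abs_norm]; exact hM₁ m hm)
      fun ε hε => ?_
    obtain ⟨M, hMM₁, hM⟩ := hback ε hε
    refine ⟨M, fun m hm p hp => ?_⟩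
    obtain ⟨u, hu, hun⟩ := hM m hm p hp
    have h1 : ‖f m‖ ≤ ‖u‖ := (hf m (hM₁0.trans (hMM₁.trans hm))).2 hu
    have h2 := norm_le_norm_add_norm_sub' u (f p)
    linarith
  have hcauchy : CauchySeq f := by
    rw [Metric.cauchySeq_iff']
    intro ε hε
    -- The second bound comes from `(a + 2ε')² - a² = 4ε'(a + ε')` with `a = ‖f m‖ ≤ B`.
    obtain ⟨ε', hε'0, hε'1, hε'⟩ : ∃ ε' : ℝ, 0 < ε' ∧ ε' ≤ ε / 4 ∧
        4 * ε' * (B + ε') < (ε / 2) ^ 2 := by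
      refine ⟨min (min (ε / 4) 1) (ε ^ 2 / (16 * (2 * B + 1))), by positivity,
        (min_le_left _ _).trans (min_le_left _ _), ?_⟩
      set e := min (min (ε / 4) 1) (ε ^ 2 / (16 * (2 * B + 1)))
      have he0 : 0 < e := by positivity
      have he1 : e ≤ 1 := (min_le_left _ _).trans (min_le_right _ _)
      have he2 : e * (16 * (2 * B + 1)) ≤ ε ^ 2 := by
        rw [← le_div_iff₀ (by positivity)]; exact min_le_right _ _
      have he3 : 0 < e * (2 * B + 1 - (B + e)) := mul_pos he0 (by linarith)
      linarith
    obtain ⟨M, hMM₁, hM⟩ := hback ε' hε'0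
    obtain ⟨N, hN⟩ := Metric.cauchySeq_iff.1 hcauchy_norm ε' hε'0
    refine ⟨max M N, fun p hp => ?_⟩
    set m := max M N
    have hmM₁ : M₁ ≤ m := hMM₁.trans (le_max_left _ _)
    obtain ⟨u, hu, hun⟩ := hM m (le_max_left _ _) p hp
    -- The point `u` is feasible for `m`, close to `f p`, and nearly as short as `f m`; the
    -- projection inequality puts it near `f m`.
    have h1 := (hf m (hM₁0.trans hmM₁)).norm_sq_add_le (hconv m) hu
    have h2 := norm_le_norm_add_norm_sub' u (f p)
    have h3 := abs_lt.1 (hN m (le_max_right _ _) p ((le_max_right _ _).trans hp))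
    have h4 : ‖u‖ ≤ ‖f m‖ + 2 * ε' := by linarith
    have h5 : ‖u - f m‖ ^ 2 < (ε / 2) ^ 2 := by
      have h6 := hM₁ m hmM₁
      have h7 := norm_nonneg (f m)
      have h8 : ‖u‖ ^ 2 ≤ (‖f m‖ + 2 * ε') ^ 2 := by gcongr
      nlinarith [mul_le_mul_of_nonneg_left h6 hε'0.le]
    have h6 : ‖u - f m‖ < ε / 2 := lt_of_pow_lt_pow_left₀ 2 (by positivity) h5
    rw [dist_eq_norm]
    have h7 : f p - f m = (u - f m) - (u - f p) := by abel
    rw [h7]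
    exact (norm_sub_le _ _).trans_lt (by linarith)
  obtain ⟨g, hg⟩ := cauchySeq_tendsto_of_complete hcauchy
  have hTg : Tendsto (fun m => T m (f m)) atTop (𝓝 (T' g)) :=
    tendsto_clm_apply_of_tendsto hT hg
  have hgmem : g ∈ feasibleSet T' C ev y := by
    refine ⟨hCcl.mem_of_tendsto hTg ((eventually_ge_atTop m₀).mono fun m hm => (hf m hm).1.1), ?_⟩
    refine tendsto_nhds_unique ((ev.continuous.tendsto _).comp hTg) ?_
    exact tendsto_const_nhds.congr'
      ((eventually_ge_atTop m₀).mono fun m hm => ((hf m hm).1.2).symm)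
  have hgn : ‖g‖ ≤ ‖f'‖ := by
    refine le_of_forall_pos_le_add fun ε hε => ?_
    obtain ⟨M, -, hM⟩ := hup ε hε
    exact le_of_tendsto hg.norm ((eventually_ge_atTop M).mono hM)
  have hgopt : IsArgmin (feasibleSet T' C ev y) (fun f => ‖f‖) g :=
    ⟨hgmem, fun h hh => hgn.trans (hf'.2 hh)⟩
  rwa [← hgopt.unique (convex_feasibleSet T' hC ev y) hf']

end LeastNorm

/-! ### Subdivisions through prescribed points -/

open Filter Topology

/-- Every finite subset of `[0,1]` consists of knots of some subdivision. -/
theorem exists_subdivision_of_finset (s : Finset ℝ) (hs : ∀ t ∈ s, t ∈ Set.Icc (0 : ℝ) 1) :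
    ∃ S : Subdivision, ∀ t ∈ s, ∃ l, S.center l = t := by
  classical
  let Q : Finset ℝ := insert 0 (insert 1 s)
  have hQ : ∀ t ∈ Q, t ∈ Set.Icc (0 : ℝ) 1 := by
    intro t ht
    simp only [Q, Finset.mem_insert] at ht
    rcases ht with rfl | rfl | ht
    · simp
    · simp
    · exact hs t ht
  have h0 : (0 : ℝ) ∈ Q := by simp [Q]
  have h1 : (1 : ℝ) ∈ Q := by simp [Q]
  let e : Fin Q.card ≃o Q := Q.orderIsoOfFin rfl
  -- Index 0 is the knot -1, the last index is the knot 2, and the points of `Q` are shifted by one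
  -- in between.
  let knot : Fin (Q.card + 2) → ℝ := fun j =>
    if j.val = 0 then -1 else if h : j.val - 1 < Q.card then (e ⟨j.val - 1, h⟩ : ℝ) else 2
  have hknot : ∀ (j : Fin (Q.card + 2)) (i : Fin Q.card), j.val = i.val + 1 → knot j = e i := by
    intro j i h
    have hi := i.isLt
    have h' : j.val - 1 < Q.card := by omega
    simp only [knot]
    rw [if_neg (by omega), dif_pos h']
    congr 2
    ext
    simp [h]
  have hcard : 2 ≤ Q.card := Finset.one_lt_card.2 ⟨0, h0, 1, h1, zero_ne_one⟩
  have hmem : ∀ i, (e i : ℝ) ∈ Set.Icc (0 : ℝ) 1 := fun i => hQ _ (e i).2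
  refine ⟨⟨Q.card, knot, ?_, by simp [knot], ?_, ?_, ?_⟩, ?_⟩
  · intro a b hab
    rw [Fin.lt_def] at hab
    have hb := b.isLt
    simp only [knot]
    split_ifs with c1 c2 c3 c4 c5 c6 c7
    · omega
    · linarith [(hmem ⟨b.val - 1, c3⟩).1]
    · norm_num
    · omega
    · exact e.strictMono (by rw [Fin.lt_def]; simp only; omega)
    · linarith [(hmem ⟨a.val - 1, c4⟩).2]
    all_goals omega
  · rw [hknot _ ⟨0, by omega⟩ (by simp)]
    refine le_antisymm ?_ (hmem _).1
    have : e ⟨0, by omega⟩ ≤ e (e.symm ⟨0, h0⟩) := e.monotone (by rw [Fin.le_def]; simp)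
    rw [e.apply_symm_apply] at this
    exact this
  · rw [hknot _ ⟨Q.card - 1, by omega⟩ (by simp; omega)]
    refine le_antisymm (hmem _).2 ?_
    have : e (e.symm ⟨1, h1⟩) ≤ e ⟨Q.card - 1, by omega⟩ := e.monotone (by
      rw [Fin.le_def]; have := (e.symm ⟨1, h1⟩).isLt; simp only; omega)
    rw [e.apply_symm_apply] at this
    exact this
  · simp [knot]
  · intro t ht
    have htQ : t ∈ Q := by simp [Q, ht]
    refine ⟨e.symm ⟨t, htQ⟩, ?_⟩
    change knot (e.symm ⟨t, htQ⟩).succ.castSucc = t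
    rw [hknot _ (e.symm ⟨t, htQ⟩) (by simp), e.apply_symm_apply]

/-- Every finite set of points of the cube consists of knots of some subdivision. -/
theorem exists_subdivision_gridPoint {ι : Type*} (P : Finset (Cube ι)) :
    ∃ S : ι → Subdivision, ∀ p ∈ P, ∃ l, gridPoint S l = p := by
  classical
  have : ∀ i, ∃ S : Subdivision, ∀ t ∈ P.image fun p => (p i : ℝ), ∃ l, S.center l = t := fun i =>
    exists_subdivision_of_finset _ fun t ht => by
      obtain ⟨p, -, rfl⟩ := Finset.mem_image.1 ht
      exact (p i).2
  choose S hS using this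
  refine ⟨S, fun p hp => ?_⟩
  choose l hl using fun i => hS i (p i) (Finset.mem_image_of_mem _ hp)
  exact ⟨l, funext fun i => Subtype.ext (hl i)⟩

theorem mem_asFunctions_iff {X : Type*} [TopologicalSpace X] {C : Set C(X, ℝ)} (g : C(X, ℝ)) :
    (g : X → ℝ) ∈ asFunctions C ↔ g ∈ C :=
  DFunLike.coe_injective.mem_set_image

/-! ### Moduli of continuity -/

theorem CovKernel.continuous_kernelSection {X : Type*} [TopologicalSpace X] (k : CovKernel X)
    (hk : Continuous (Function.uncurry k.toFun)) : Continuous k.kernelSection := by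
  rw [continuous_iff_continuousAt]
  intro x
  rw [ContinuousAt, tendsto_iff_norm_sub_tendsto_zero]
  have hc : Continuous fun z => k.toFun z z - 2 * k.toFun z x + k.toFun x x := by
    have h1 : Continuous fun z => k.toFun z z := hk.comp (continuous_id.prodMk continuous_id)
    have h2 : Continuous fun z => k.toFun z x := hk.comp (continuous_id.prodMk continuous_const)
    fun_prop
  have h := (hc.tendsto x).sqrt
  have h0 : k.toFun x x - 2 * k.toFun x x + k.toFun x x = 0 := by ring
  rw [h0, Real.sqrt_zero] at h
  refine h.congr fun z => ?_
  rw [← k.norm_kernelSection_sub_sq, Real.sqrt_sq (norm_nonneg _)]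

/-- A continuous function into a normed space satisfies a modulus of continuity of the form
`η + κ ∑ |s i - t i|` on the cube. -/
theorem exists_linear_modulus {ι H : Type*} [Fintype ι] [NormedAddCommGroup H] {φ : Cube ι → H}
    (hφ : Continuous φ) {η : ℝ} (hη : 0 < η) :
    ∃ κ ≥ 0, ∀ s t : Cube ι, ‖φ s - φ t‖ ≤ η + κ * ∑ i, |(s i : ℝ) - t i| := by
  obtain ⟨ρ, hρ, hu⟩ := Metric.uniformContinuous_iff.1
    (CompactSpace.uniformContinuous_of_continuous hφ) η hη
  obtain ⟨B, hB⟩ := isCompact_univ.exists_bound_of_continuousOn hφ.continuousOn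
  have hB0 : 0 ≤ B := (norm_nonneg _).trans (hB (fun _ => 0) (Set.mem_univ _))
  refine ⟨2 * B / ρ, by positivity, fun s t => ?_⟩
  have hs : 0 ≤ ∑ i, |(s i : ℝ) - t i| := Finset.sum_nonneg fun _ _ => abs_nonneg _
  -- Nearby points: uniform continuity gives `η`. Distant points: the total oscillation `2 * B` is
  -- absorbed by the linear term.
  rcases lt_or_ge (dist s t) ρ with h | h
  · have := hu h
    rw [dist_eq_norm] at this
    have h2 : 0 ≤ 2 * B / ρ * ∑ i, |(s i : ℝ) - t i| := by positivity
    linarith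
  · have h1 : dist s t ≤ ∑ i, |(s i : ℝ) - t i| := by
      refine (dist_pi_le_iff hs).2 fun i => ?_
      exact Finset.single_le_sum (f := fun i => |(s i : ℝ) - t i|) (fun _ _ => abs_nonneg _)
        (Finset.mem_univ i)
    calc ‖φ s - φ t‖ ≤ B + B :=
          (norm_sub_le _ _).trans (add_le_add (hB s trivial) (hB t trivial))
      _ = 2 * B / ρ * ρ := by field_simp; ring
      _ ≤ 2 * B / ρ * ∑ i, |(s i : ℝ) - t i| := by gcongr; exact h.trans h1
      _ ≤ _ := by linarith

/-! ### Projections as operators and their norm limit -/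

section Operators

variable {ι : Type*} [Fintype ι] [DecidableEq ι]

/-- The spline `Y_{S,α}` as a continuous function, depending linearly on `α`. -/
noncomputable def splineOp (S : ι → Subdivision) :
    (MultiIndex S → ℝ) →L[ℝ] C(Cube ι, ℝ) :=
  LinearMap.toContinuousLinearMap
    { toFun := fun α => ⟨spline S α, continuous_spline S α⟩
      map_add' := fun α β => by
        ext t
        simp [spline, add_mul, Finset.sum_add_distrib]
      map_smul' := fun c α => by
        ext t
        simp [spline, Finset.mul_sum, mul_assoc] }

theorem coe_splineOp (S : ι → Subdivision) (α : MultiIndex S → ℝ) :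
    ⇑(splineOp S α) = spline S α := rfl

/-- The projection of the elements of a reproducing kernel Hilbert space on the splines. -/
noncomputable def projOp (k : CovKernel (Cube ι)) (S : ι → Subdivision) :
    k.Space →L[ℝ] C(Cube ι, ℝ) :=
  (splineOp S).comp (ContinuousLinearMap.pi fun l => innerSL ℝ (k.kernelSection (gridPoint S l)))

theorem projOp_apply (k : CovKernel (Cube ι)) (S : ι → Subdivision) (f : k.Space) :
    projOp k S f = splineOp S fun l => f (gridPoint S l) := by
  have : (fun l => innerSL ℝ (k.kernelSection (gridPoint S l)) f) = fun l => f (gridPoint S l) :=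
    funext fun l => by rw [innerSL_apply_apply, real_inner_comm, k.inner_kernelSection]
  rw [← this]
  rfl

theorem coe_projOp (k : CovKernel (Cube ι)) (S : ι → Subdivision) (f : k.Space) :
    ⇑(projOp k S f) = proj S f := by
  rw [projOp_apply, coe_splineOp]
  rfl

/-- The projections converge to the multiaffine extension, uniformly on the balls of the reproducing
kernel Hilbert space. -/
theorem exists_abs_proj_sub_multiaffineExt_le (k : CovKernel (Cube ι))
    (hk : Continuous (Function.uncurry k.toFun)) {m₀ : ℕ} {S : ℕ → ι → Subdivision}
    (hS : ∀ m ≥ m₀, ∀ i, (S m i).knotSet ⊆ (S (m + 1) i).knotSet) {ε : ℝ} (hε : 0 < ε) :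
    ∃ M ≥ m₀, ∀ m ≥ M, ∀ (f : k.Space) (t : Cube ι),
      |proj (S m) f t - multiaffineExt (knotClosure m₀ S) (fun t => f t.1) t| ≤ ε * ‖f‖ := by
  obtain ⟨κ, hκ, hmod⟩ := exists_linear_modulus (k.continuous_kernelSection hk) (half_pos hε)
  set c : ℝ := κ * (Fintype.card ι * 2) with hc
  have hc0 : 0 ≤ c := by positivity
  -- This mesh makes the linear part of the error at most `ε / 2 * ‖f‖`; `c + 1` avoids dividing by
  -- zero.
  obtain ⟨M, hM0, hM⟩ := exists_forall_exists_center_near hS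
    (show 0 < ε / 2 / (c + 1) by positivity)
  refine ⟨M, hM0, fun m hm f t =>
    abs_proj_sub_multiaffineExt_le (knotsIn_knotClosure (hM0.trans hm)) (fun s hs => ?_) t⟩
  have h := abs_proj_sub_le (S m) (f := f) (t := s) (η := ‖f‖ * (ε / 2)) (κ := ‖f‖ * κ)
    (δ := ε / 2 / (c + 1)) (by positivity) (fun l => by
      refine (k.abs_apply_sub_le f _ _).trans ?_
      rw [mul_assoc, ← mul_add]
      exact mul_le_mul_of_nonneg_left (hmod _ _) (norm_nonneg f)) (fun i => hM m hm i _ (hs i))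
  refine h.trans ?_
  have h2 : c * (ε / 2 / (c + 1)) ≤ ε / 2 := by
    rw [← mul_div_assoc, div_le_iff₀ (by positivity)]
    nlinarith
  calc ‖f‖ * (ε / 2) + ‖f‖ * κ * (Fintype.card ι * (2 * (ε / 2 / (c + 1))))
      = ‖f‖ * (ε / 2 + c * (ε / 2 / (c + 1))) := by rw [hc]; ring
    _ ≤ ‖f‖ * (ε / 2 + ε / 2) := by gcongr
    _ = ε * ‖f‖ := by ring

end Operators

/-- A sequence of operators that is uniformly Cauchy on balls converges in norm. -/
theorem exists_tendsto_of_uniform_cauchy {G W : Type*} [NormedAddCommGroup G] [NormedSpace ℝ G]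
    [NormedAddCommGroup W] [NormedSpace ℝ W] [CompleteSpace W] {T : ℕ → G →L[ℝ] W}
    (h : ∀ ε > 0, ∃ M, ∀ m ≥ M, ∀ p ≥ M, ∀ f, ‖T m f - T p f‖ ≤ ε * ‖f‖) :
    ∃ T' : G →L[ℝ] W, Tendsto T atTop (𝓝 T') := by
  refine cauchySeq_tendsto_of_complete (Metric.cauchySeq_iff.2 fun ε hε => ?_)
  obtain ⟨M, hM⟩ := h (ε / 2) (half_pos hε)
  refine ⟨M, fun m hm p hp => ?_⟩
  rw [dist_eq_norm]
  exact ((T m - T p).opNorm_le_bound (half_pos hε).le (hM m hm p hp)).trans_lt (half_lt_self hε)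

/-- Operators into continuous functions that converge uniformly on balls converge in norm. -/
theorem exists_tendsto_of_uniform {G X : Type*} [NormedAddCommGroup G] [NormedSpace ℝ G]
    [TopologicalSpace X] [CompactSpace X] {T : ℕ → G →L[ℝ] C(X, ℝ)} {P : G → X → ℝ}
    (h : ∀ ε > 0, ∃ M, ∀ m ≥ M, ∀ f t, |T m f t - P f t| ≤ ε * ‖f‖) :
    ∃ T' : G →L[ℝ] C(X, ℝ), Tendsto T atTop (𝓝 T') ∧ ∀ f, ⇑(T' f) = P f := by
  obtain ⟨T', hT'⟩ := exists_tendsto_of_uniform_cauchy (T := T) fun ε hε => by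
    obtain ⟨M, hM⟩ := h (ε / 2) (half_pos hε)
    refine ⟨M, fun m hm p hp f => ?_⟩
    rw [ContinuousMap.norm_le _ (by positivity)]
    intro t
    have h1 := hM m hm f t
    have h2 := hM p hp f t
    calc ‖(T m f - T p f) t‖ = |(T m f t - P f t) - (T p f t - P f t)| := by
          rw [Real.norm_eq_abs, ContinuousMap.sub_apply]; congr 1; ring
      _ ≤ |T m f t - P f t| + |T p f t - P f t| := abs_sub _ _
      _ ≤ ε * ‖f‖ := by linarith
  refine ⟨T', hT', fun f => funext fun t => ?_⟩
  have h1 : Tendsto (fun m => T m f t) atTop (𝓝 (T' f t)) :=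
    ((ContinuousMap.evalCLM ℝ t).continuous.tendsto _).comp
      (((ContinuousLinearMap.apply ℝ C(X, ℝ) f).continuous.tendsto T').comp hT')
  refine tendsto_nhds_unique h1 ?_
  rw [Metric.tendsto_atTop]
  intro ε hε
  obtain ⟨M, hM⟩ := h (ε / (‖f‖ + 1)) (by positivity)
  refine ⟨M, fun m hm => ?_⟩
  rw [Real.dist_eq]
  refine (hM m hm f t).trans_lt ?_
  rw [div_mul_eq_mul_div, div_lt_iff₀ (by positivity)]
  nlinarith [norm_nonneg f]

/-! ### Coefficient vectors as least norm problems -/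

section Mode

variable {ι : Type*} [Fintype ι] [DecidableEq ι]

/-- Evaluation of continuous functions at the observation points. -/
noncomputable def evalAt {X : Type*} [TopologicalSpace X] [CompactSpace X] {n : ℕ}
    (U : Fin n → X) : C(X, ℝ) →L[ℝ] (Fin n → ℝ) :=
  ContinuousLinearMap.pi fun i => ContinuousMap.evalCLM ℝ (U i)

theorem evalAt_eq_iff {X : Type*} [TopologicalSpace X] [CompactSpace X] {n : ℕ} {U : Fin n → X}
    {y : Fin n → ℝ} {g : C(X, ℝ)} : evalAt U g = y ↔ (g : X → ℝ) ∈ interpolating U y :=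
  funext_iff

theorem mem_feasibleSet_evalAt {G X : Type*} [NormedAddCommGroup G] [InnerProductSpace ℝ G]
    [TopologicalSpace X] [CompactSpace X] {n : ℕ} {U : Fin n → X} {y : Fin n → ℝ}
    {T : G →L[ℝ] C(X, ℝ)} {C : Set C(X, ℝ)} {f : G} :
    f ∈ feasibleSet T C (evalAt U) y ↔
      (T f : X → ℝ) ∈ asFunctions C ∧ (T f : X → ℝ) ∈ interpolating U y := by
  rw [mem_asFunctions_iff, ← evalAt_eq_iff]
  rfl

theorem CovKernel.exists_isometric_extension_restrictKernel {ι : Type*} (F : ι → AxisSet)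
    (k : CovKernel (Cube ι)) :
    ∃ E : (restrictKernel F k).Space →L[ℝ] k.Space,
      (∀ f, ‖E f‖ = ‖f‖) ∧ ∀ f (t : prodSet F), E f t.1 = f t :=
  k.exists_isometric_extension (Subtype.val : prodSet F → Cube ι)

theorem CovKernel.exists_restriction_restrictKernel {ι : Type*} (F : ι → AxisSet)
    (k : CovKernel (Cube ι)) :
    ∃ R : k.Space →L[ℝ] (restrictKernel F k).Space,
      (∀ f, ‖R f‖ ≤ ‖f‖) ∧ ∀ f (t : prodSet F), R f t = f t.1 :=
  k.exists_restriction (Subtype.val : prodSet F → Cube ι)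

/-- The coefficient vectors correspond to interpolants of least norm in the space of the restricted
kernel. -/
theorem exists_coeffLift {F : ι → AxisSet} (k : CovKernel (Cube ι)) {S : ι → Subdivision}
    (hS : KnotsIn F S) (hinv : IsUnit (k.gridMatrix S))
    {E : (restrictKernel F k).Space →L[ℝ] k.Space} (hE : ∀ f, ‖E f‖ = ‖f‖)
    (hEF : ∀ f (t : prodSet F), E f t.1 = f t) :
    ∃ Φ : (MultiIndex S → ℝ) → (restrictKernel F k).Space,
      (∀ α l, E (Φ α) (gridPoint S l) = α l) ∧
      (∀ α, ‖Φ α‖ ^ 2 = α ⬝ᵥ (k.gridMatrix S)⁻¹.mulVec α) ∧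
      ∀ α f, (∀ l, E f (gridPoint S l) = α l) → ‖Φ α‖ ≤ ‖f‖ := by
  obtain ⟨R, hR, hRF⟩ := CovKernel.exists_restriction_restrictKernel F k
  choose h hh hn hmin using
    k.exists_minNorm_interpolant (gridPoint S) (k.gridMatrix S) (fun _ _ => rfl) hinv
  have hval : ∀ α l, E (R (h α)) (gridPoint S l) = α l := fun α l =>
    (hEF (R (h α)) ⟨_, hS.gridPoint_mem l⟩).trans ((hRF _ _).trans (hh α l))
  refine ⟨fun α => R (h α), hval, fun α => ?_, fun α f hf => ?_⟩
  · rw [← hn α]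
    congr 1
    -- Restricting `h α` loses no norm: `E (R (h α))` still interpolates `α`, so minimality of `h α`
    -- gives the converse inequality.
    refine le_antisymm (hR _) ?_
    rw [← hE]
    exact hmin α _ (hval α)
  · rw [← hE f]
    exact (hR _).trans (hmin α _ hf)

section Correspondence

variable {G : Type*} [NormedAddCommGroup G] [InnerProductSpace ℝ G]
  {k : CovKernel (Cube ι)} {S : ι → Subdivision} {E : G →L[ℝ] k.Space}
  {Φ : (MultiIndex S → ℝ) → G} {C : Set C(Cube ι, ℝ)} {n : ℕ} {U : Fin n → Cube ι} {y : Fin n → ℝ}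

theorem coe_projOp_comp_lift (hΦ : ∀ α l, E (Φ α) (gridPoint S l) = α l) (α : MultiIndex S → ℝ) :
    ⇑((projOp k S).comp E (Φ α)) = spline S α := by
  rw [ContinuousLinearMap.comp_apply, projOp_apply, coe_splineOp]
  simp only [hΦ]

theorem lift_mem_feasibleSet (hΦ : ∀ α l, E (Φ α) (gridPoint S l) = α l)
    {α : MultiIndex S → ℝ} (hα : spline S α ∈ interpolating U y ∩ asFunctions C) :
    Φ α ∈ feasibleSet ((projOp k S).comp E) C (evalAt U) y := by
  rw [mem_feasibleSet_evalAt, coe_projOp_comp_lift hΦ]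
  exact hα.symm

theorem spline_mem_of_mem_feasibleSet {f : G}
    (hf : f ∈ feasibleSet ((projOp k S).comp E) C (evalAt U) y) :
    spline S (fun l => E f (gridPoint S l)) ∈ interpolating U y ∩ asFunctions C := by
  rw [mem_feasibleSet_evalAt, ContinuousLinearMap.comp_apply, projOp_apply, coe_splineOp] at hf
  exact hf.symm

/-- Replacing `f` by the lift of its knot values keeps the spline, hence feasibility, and does not
increase the norm. -/
theorem IsModeCoeff.isArgmin_lift (hΦ : ∀ α l, E (Φ α) (gridPoint S l) = α l)
    (hn : ∀ α, ‖Φ α‖ ^ 2 = α ⬝ᵥ (k.gridMatrix S)⁻¹.mulVec α)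
    (hmin : ∀ α f, (∀ l, E f (gridPoint S l) = α l) → ‖Φ α‖ ≤ ‖f‖)
    {α : MultiIndex S → ℝ} (hα : IsModeCoeff k C U y S α) :
    IsArgmin (feasibleSet ((projOp k S).comp E) C (evalAt U) y) (fun f => ‖f‖) (Φ α) := by
  refine ⟨lift_mem_feasibleSet hΦ hα.1, fun f hf => ?_⟩
  have h : α ⬝ᵥ (k.gridMatrix S)⁻¹.mulVec α ≤ _ := hα.2 (spline_mem_of_mem_feasibleSet hf)
  simp only [← hn] at h
  exact (le_of_sq_le_sq h (norm_nonneg _)).trans (hmin _ f fun _ => rfl)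

theorem isModeCoeff_of_isArgmin (hΦ : ∀ α l, E (Φ α) (gridPoint S l) = α l)
    (hn : ∀ α, ‖Φ α‖ ^ 2 = α ⬝ᵥ (k.gridMatrix S)⁻¹.mulVec α)
    (hmin : ∀ α f, (∀ l, E f (gridPoint S l) = α l) → ‖Φ α‖ ≤ ‖f‖) {f : G}
    (hf : IsArgmin (feasibleSet ((projOp k S).comp E) C (evalAt U) y) (fun f => ‖f‖) f) :
    IsModeCoeff k C U y S fun l => E f (gridPoint S l) := by
  refine ⟨spline_mem_of_mem_feasibleSet hf.1, fun β hβ => ?_⟩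
  have h : ‖f‖ ≤ ‖Φ β‖ := hf.2 (lift_mem_feasibleSet hΦ hβ)
  change _ ≤ β ⬝ᵥ (k.gridMatrix S)⁻¹.mulVec β
  simp only [← hn]
  gcongr
  exact (hmin _ f fun _ => rfl).trans h

end Correspondence

/-! ### The general theorem -/

/-- The points at which the multiaffine extension evaluates its argument at the points `U`. -/
noncomputable def neighbours (F : ι → AxisSet) {n : ℕ} (U : Fin n → Cube ι) :
    Finset (Cube ι) :=
  open scoped Classical in
  (Finset.univ : Finset (Fin n × (ι → Bool))).image fun q j => (F j).nbr (q.2 j) (U q.1 j)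

theorem multiaffineExt_congr {F : ι → AxisSet} {n : ℕ} {U : Fin n → Cube ι} {f g : Cube ι → ℝ}
    (h : ∀ p ∈ neighbours F U, f p = g p) (i : Fin n) :
    multiaffineExt F (fun t => f t.1) (U i) = multiaffineExt F (fun t => g t.1) (U i) := by
  classical
  refine Finset.sum_congr rfl fun e _ => ?_
  congr 1
  exact h _ (Finset.mem_image.2 ⟨(i, e), Finset.mem_univ _, rfl⟩)

/-- The convergence theorem for a general finite set of coordinates. -/
theorem existsUnique_mode_and_tendsto (k : CovKernel (Cube ι))
    (hk : Continuous (Function.uncurry k.toFun)) (C : Set C(Cube ι, ℝ))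
    (hinv : ∀ S : ι → Subdivision, IsUnit (k.gridMatrix S))
    {n : ℕ} (U : Fin n → Cube ι) (y : Fin n → ℝ) (m₀ : ℕ) (S : ℕ → ι → Subdivision)
    (hnested : ∀ m ≥ m₀, ∀ i, (S m i).knotSet ⊆ (S (m + 1) i).knotSet)
    (Cdot : Set C(Cube ι, ℝ)) (hCdot : Cdot ⊆ C) (hconv : Convex ℝ C) (hcl : IsClosed C)
    (h2 : StrictlyFeasible Cdot U y (S m₀)) (h3 : SpansValues U (S m₀))
    (h4 : RKHSInterior k C Cdot) (h5 : ProjectionStable C)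
    (h6 : ExtensionStable (knotClosure m₀ S) C) :
    (∀ m ≥ m₀, ∃! α : MultiIndex (S m) → ℝ, IsModeCoeff k C U y (S m) α) ∧
    (∃! Y : (restrictKernel (knotClosure m₀ S) k).Space,
      IsOptimal (knotClosure m₀ S) k C U y Y) ∧
    ∀ (α : (m : ℕ) → MultiIndex (S m) → ℝ) (Y : (restrictKernel (knotClosure m₀ S) k).Space),
      (∀ m ≥ m₀, IsModeCoeff k C U y (S m) (α m)) →
      IsOptimal (knotClosure m₀ S) k C U y Y →
      TendstoUniformly (fun m => spline (S m) (α m))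
        (multiaffineExt (knotClosure m₀ S) Y) Filter.atTop := by
  classical
  set F := knotClosure m₀ S with hF
  have hknots : ∀ m ≥ m₀, KnotsIn F (S m) := fun m hm => knotsIn_knotClosure hm
  obtain ⟨E, hE, hEF⟩ := CovKernel.exists_isometric_extension_restrictKernel F k
  obtain ⟨R, -, hRF⟩ := CovKernel.exists_restriction_restrictKernel F k
  let T : ℕ → (restrictKernel F k).Space →L[ℝ] C(Cube ι, ℝ) := fun m => (projOp k (S m)).comp E
  have hTcoe : ∀ m f, ⇑(T m f) = proj (S m) (E f) := fun m f => coe_projOp k (S m) (E f)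
  have hEfun : ∀ f : (restrictKernel F k).Space, (fun t : prodSet F => E f t.1) = f :=
    fun f => funext fun t => hEF f t
  obtain ⟨T', hT, hT'⟩ := exists_tendsto_of_uniform (T := T)
    (P := fun f => multiaffineExt F f) (fun ε hε => by
      obtain ⟨M, -, hM⟩ := exists_abs_proj_sub_multiaffineExt_le k hk hnested hε
      refine ⟨M, fun m hm f t => ?_⟩
      have := hM m hm (E f) t
      rw [hE, hEfun] at this
      rwa [hTcoe])
  have hT'E : ∀ f, ⇑(T' f) = multiaffineExt F fun t => E f t.1 := fun f => by rw [hT', hEfun]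
  have hfeas : ∀ f, f ∈ feasibleSet T' C (evalAt U) y ↔
      (f : prodSet F → ℝ) ∈ pullbackConstraints F C ∩ pullbackInterpolating F U y := fun f => by
    rw [mem_feasibleSet_evalAt, hT']
    rfl
  have hopt : ∀ Y, IsOptimal F k C U y Y ↔
      IsArgmin (feasibleSet T' C (evalAt U) y) (fun f => ‖f‖) Y := fun Y => by
    rw [Set.ext hfeas]
    rfl
  -- stability of the constraint under the projections
  have hnest : ∀ m ≥ m₀, ∀ p ≥ m, ∀ f, T p f ∈ C → T m f ∈ C := by
    intro m hm p hp f hf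
    have := h5 (S m) _ hf
    rw [hTcoe, proj_proj_of_subset (knotSet_subset_of_le hnested hm hp), ← hTcoe] at this
    exact (mem_asFunctions_iff _).1 this
  have hproj : ∀ m ≥ m₀, ∀ f, T' f ∈ C → T m f ∈ C := by
    intro m hm f hf
    have := h5 (S m) _ hf
    rw [hT'E, proj_multiaffineExt (hknots m hm), ← hTcoe] at this
    exact (mem_asFunctions_iff _).1 this
  -- restrictions of interpolants on the neighbours of the observations
  have hRE : ∀ (h : k.Space) (w : (restrictKernel F k).Space),
      ⇑(T' (R h + w)) = multiaffineExt F fun t => (h + E w) t.1 := by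
    intro h w
    rw [hT']
    congr 1
    funext t
    simp only [RKHS.coe_add, Pi.add_apply]
    rw [hEF]
    exact congrArg (· + w t) (hRF h t)
  have hspl : ∀ (h : k.Space) (α : MultiIndex (S m₀) → ℝ),
      (∀ p ∈ neighbours F U, h p = spline (S m₀) α p) →
        evalAt U (T' (R h)) = fun i => spline (S m₀) α (U i) := by
    intro h α hα
    funext i
    have h1 := congrFun (hRE h 0) (U i)
    simp only [add_zero, map_zero] at h1
    rw [multiaffineExt_congr hα, multiaffineExt_spline (hknots m₀ le_rfl)] at h1
    exact h1
  -- an interior point of the limit problem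
  obtain ⟨α₀, hα₀, hα₀C⟩ := h2
  obtain ⟨g₀, r, hr, hball, hg₀⟩ : ∃ (g₀ : (restrictKernel F k).Space) (r : ℝ), 0 < r ∧
      (∀ w, ‖w‖ < r → T' (g₀ + w) ∈ C) ∧ evalAt U (T' g₀) = y := by
    obtain ⟨h, hhC, hh⟩ := hα₀C
    -- Observations need not lie in `F`, so the interior function is matched with the feasible
    -- spline at their neighbours in `F`; its extension then has the right values at `U`.
    obtain ⟨f₁, hf₁, hf₁h⟩ := h4 h hhC (neighbours F U).card
      (fun i => ((neighbours F U).equivFin.symm i).1)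
      (Subtype.val_injective.comp (Equiv.injective _))
    obtain ⟨r, hr, hball⟩ := Metric.mem_nhds_iff.1 (mem_interior_iff_mem_nhds.1 hf₁)
    refine ⟨R f₁, r, hr, fun w hw => ?_, ?_⟩
    -- `E` carries the ball of `H_F` into the ball of `H` contained in the constraint; stability
    -- under extension then applies.
    · obtain ⟨q, hqC, hq⟩ := hball (show f₁ + E w ∈ Metric.ball f₁ r by
        rw [mem_ball_iff_norm, add_sub_cancel_left, hE]; exact hw)
      have h7 := h6 q hqC
      rw [← mem_asFunctions_iff, hRE, ← hq]
      exact h7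
    · rw [hspl f₁ α₀]
      · exact funext hα₀
      · intro p hp
        have h7 := hf₁h ((neighbours F U).equivFin ⟨p, hp⟩)
        simp only [Equiv.symm_apply_apply] at h7
        rw [h7]
        exact congrFun hh p
  have hsurj : Function.Surjective fun f => evalAt U (T' f) := by
    intro z
    obtain ⟨α, rfl⟩ : z ∈ {w : Fin n → ℝ | ∃ α, w = fun i => spline (S m₀) α (U i)} := by
      have h3' : {w : Fin n → ℝ | ∃ α, w = fun i => spline (S m₀) α (U i)} = Set.univ := h3
      rw [h3']; trivial
    -- Invertibility of the kernel matrix on a grid through the neighbours lets an element of `H`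
    -- copy the spline there.
    obtain ⟨S', hS'⟩ := exists_subdivision_gridPoint (neighbours F U)
    obtain ⟨h, hh, -⟩ := k.exists_minNorm_interpolant (gridPoint S') (k.gridMatrix S')
      (fun _ _ => rfl) (hinv S') fun l => spline (S m₀) α (gridPoint S' l)
    refine ⟨R h, hspl h α fun p hp => ?_⟩
    obtain ⟨l, rfl⟩ := hS' p hp
    exact hh l
  have hcv := fun A : (restrictKernel F k).Space →L[ℝ] C(Cube ι, ℝ) =>
    convex_feasibleSet A hconv (evalAt U) y
  have hclosed := fun A : (restrictKernel F k).Space →L[ℝ] C(Cube ι, ℝ) =>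
    isClosed_feasibleSet A hcl (evalAt U) y
  refine ⟨fun m hm => ?_, ?_, fun α Y hα hY => ?_⟩
  · obtain ⟨Φ, hΦ, hn, hmin⟩ := exists_coeffLift k (hknots m hm) (hinv (S m)) hE hEF
    have hne : (feasibleSet (T m) C (evalAt U) y).Nonempty := by
      -- The initial feasible spline is also a spline on every finer grid.
      have h7 : spline (S m) (fun l => spline (S m₀) α₀ (gridPoint (S m) l)) =
          spline (S m₀) α₀ :=
        proj_spline_of_subset (knotSet_subset_of_le hnested le_rfl hm) α₀
      refine ⟨_, lift_mem_feasibleSet (α := fun l => spline (S m₀) α₀ (gridPoint (S m) l)) hΦ ?_⟩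
      rw [h7]
      exact ⟨hα₀, Set.image_mono hCdot hα₀C⟩
    obtain ⟨f, hf⟩ := exists_isArgmin_norm hne (hclosed _) (hcv _)
    refine ⟨_, isModeCoeff_of_isArgmin hΦ hn hmin hf, fun β hβ => ?_⟩
    -- Any optimal `β` lifts to the unique minimizer, from whose knot values it is recovered.
    rw [← (hβ.isArgmin_lift hΦ hn hmin).unique (hcv _) hf]
    exact funext fun l => (hΦ β l).symm
  · have hne : (feasibleSet T' C (evalAt U) y).Nonempty :=
      ⟨g₀, by simpa using hball 0 (by simpa using hr), hg₀⟩
    obtain ⟨f, hf⟩ := exists_isArgmin_norm hne (hclosed _) (hcv _)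
    exact ⟨f, (hopt f).2 hf, fun Y hY => ((hopt Y).1 hY).unique (hcv _) hf⟩
  · have hlift : ∀ m, ∃ f : (restrictKernel F k).Space, m₀ ≤ m →
        IsArgmin (feasibleSet (T m) C (evalAt U) y) (fun f => ‖f‖) f ∧
          ⇑(T m f) = spline (S m) (α m) := by
      intro m
      by_cases hm : m₀ ≤ m
      · obtain ⟨Φ, hΦ, hn, hmin⟩ := exists_coeffLift k (hknots m hm) (hinv (S m)) hE hEF
        exact ⟨Φ (α m), fun _ =>
          ⟨(hα m hm).isArgmin_lift hΦ hn hmin, coe_projOp_comp_lift hΦ _⟩⟩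
      -- An arbitrary value below `m₀`, irrelevant to the limit.
      · exact ⟨0, fun h => absurd h hm⟩
    choose f hf using hlift
    have hlim := tendsto_isArgmin_feasibleSet hT hconv hcl hnest hproj hr hball hg₀ hsurj
      (fun m hm => (hf m hm).1) ((hopt Y).1 hY)
    have hTf := tendsto_clm_apply_of_tendsto hT hlim
    rw [ContinuousMap.tendsto_iff_tendstoUniformly, hT'] at hTf
    intro u hu
    filter_upwards [hTf u hu, eventually_ge_atTop m₀] with m h hm t
    rw [← (hf m hm).2]
    exact h t

end Mode

/-! ### Reduction to the active variables -/

theorem continuous_extendZero {D : ℕ} (J : Finset (Fin D)) : Continuous (extendZero J) := by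
  refine continuous_pi fun i => ?_
  by_cases h : i ∈ J
  · simpa [extendZero, h] using continuous_apply (⟨i, h⟩ : J)
  · simpa [extendZero, h] using continuous_const

theorem convex_activeConstraints {D : ℕ} (J : Finset (Fin D)) {CD : Set C(Cube (Fin D), ℝ)}
    (h : Convex ℝ CD) : Convex ℝ (activeConstraints J CD) :=
  fun _ hf _ hg _ _ ha hb hab => h hf hg ha hb hab

theorem isClosed_activeConstraints {D : ℕ} (J : Finset (Fin D)) {CD : Set C(Cube (Fin D), ℝ)}
    (h : IsClosed CD) : IsClosed (activeConstraints J CD) :=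
  h.preimage (ContinuousMap.continuous_precomp (restrictTo J))

end ConstrainedMode

theorem mainTheorem2 {D : ℕ}
    -- the ambient covariance function and inequality constraint set, and the active variables
    (kD : CovKernel (Cube (Fin D))) (hkD : Continuous (Function.uncurry kD.toFun))
    (CD : Set C(Cube (Fin D), ℝ)) (J : Finset (Fin D))
    (hinv : ∀ S : J → Subdivision, IsUnit ((activeKernel J kD).gridMatrix S))
    -- the observations
    {n : ℕ} (x : Fin n → Cube (Fin D)) (y : Fin n → ℝ)
    -- the nested subdivisions
    (m₀ : ℕ) (S : ℕ → J → Subdivision)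
    (hnested : ∀ m ≥ m₀, ∀ i, (S m i).knotSet ⊆ (S (m + 1) i).knotSet)
    -- the set of functions satisfying the strict inequality constraints
    (Cdot : Set C(Cube J, ℝ)) (hCdot : Cdot ⊆ activeConstraints J CD)
    -- the six conditions
    (h1 : Convex ℝ CD ∧ IsClosed CD)
    (h2 : StrictlyFeasible Cdot (fun i => restrictTo J (x i)) y (S m₀))
    (h3 : SpansValues (fun i => restrictTo J (x i)) (S m₀))
    (h4 : RKHSInterior (activeKernel J kD) (activeConstraints J CD) Cdot)
    (h5 : ProjectionStable (activeConstraints J CD))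
    (h6 : ExtensionStable (knotClosure m₀ S) (activeConstraints J CD)) :
    -- the modes and the constrained interpolator are well defined
    (∀ m ≥ m₀, ∃! α : MultiIndex (S m) → ℝ,
      IsModeCoeff (activeKernel J kD) (activeConstraints J CD)
        (fun i => restrictTo J (x i)) y (S m) α) ∧
    (∃! Y : (restrictKernel (knotClosure m₀ S) (activeKernel J kD)).Space,
      IsOptimal (knotClosure m₀ S) (activeKernel J kD) (activeConstraints J CD)
        (fun i => restrictTo J (x i)) y Y) ∧
    -- and the modes converge uniformly to the multiaffine extension of the interpolator
    ∀ (α : (m : ℕ) → MultiIndex (S m) → ℝ)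
      (Y : (restrictKernel (knotClosure m₀ S) (activeKernel J kD)).Space),
      (∀ m ≥ m₀, IsModeCoeff (activeKernel J kD) (activeConstraints J CD)
        (fun i => restrictTo J (x i)) y (S m) (α m)) →
      IsOptimal (knotClosure m₀ S) (activeKernel J kD) (activeConstraints J CD)
        (fun i => restrictTo J (x i)) y Y →
      TendstoUniformly (fun m => spline (S m) (α m))
        (multiaffineExt (knotClosure m₀ S) Y) Filter.atTop := by
  have hk : Continuous (Function.uncurry (activeKernel J kD).toFun) :=
    hkD.comp ((continuous_extendZero J).prodMap (continuous_extendZero J))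
  exact existsUnique_mode_and_tendsto _ hk _ hinv _ y m₀ S hnested Cdot hCdot
    (convex_activeConstraints J h1.1) (isClosed_activeConstraints J h1.2) h2 h3 h4 h5 h6
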